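/- Let $m\ge 2$ and let $T_m$ be the $m$-adic rooted tree, whose vertices are the finite words over an alphabet of $m$ letters, the $n$th level being the set of words of length $n$. Let $\mathrm{Aut}\,T_m$ be the group of graph automorphisms of $T_m$ fixing the root, let $\mathrm{St}(n)$ be the subgroup fixing every vertex of the $n$th level, and give $\mathrm{Aut}\,T_m$ the congruence topology, in which the subgroups $\mathrm{St}(n)$ form a basis of neighbourhoods of the identity. The section of $g\in\mathrm{Aut}\,T_m$ at a vertex $v$ is the automorphism $g|_v$ with $g(vu)=g(v)\,g|_v(u)$ for every word $u$. A subgroup $G\le\mathrm{Aut}\,T_m$ is *regular branch* if it is self-similar (all sections of elements of $G$ lie in $G$), acts transitively on every level, and has a finite-index subgroup $K$ such that for all $k_1,\dots,k_m\in K$ there is $g\in K\cap\mathrm{St}(1)$ whose sections at the $m$ vertices of the first level are $k_1,\dots,k_m$. A *filtration* of a profinite group $\Gamma$ is a descending chain $\mathcal N=\{\Gamma_i\}_{i\ge0}$ of open normal subgroups with $\Gamma_0=\Gamma$ and $\bigcap_i\Gamma_i=1$. For infinite $\Gamma$ it induces the metric $d(x,y)=\inf\{|\Gamma:\Gamma_i|^{-1}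 : xy^{-1}\in\Gamma_i\}$ on $\Gamma$. Let $\mathrm{hspec}^{\mathcal N}(\Gamma)$ be the set of Hausdorff dimensions, with respect to this metric, of the closed subgroups of $\Gamma$; let $\mathrm{hspec}^{\mathcal N}_{\mathrm{fg}}(\Gamma)$ be the set of those of the closed subgroups that are topologically finitely generated, and $\mathrm{hspec}^{\mathcal N}_{b}(\Gamma)$ the set of those of the closed subgroups that are topologically generated by at most $b$ elements. For a closed subgroup $\Gamma\le\mathrm{Aut}\,T_m$ let $\mathcal S=\{\mathrm{St}(n)\cap\Gamma\}_{n\ge0}$. For a vertex $v$ let $\mathrm{rist}_\Gamma(v)$ be the subgroup of the elements of $\Gamma$ that fix $v$ and every vertex outside the subtree rooted at $v$, and let $\mathrm{Rist}_\Gamma(k)$ be the product of the groups $\mathrm{rist}_\Gamma(v)$ over all $v$ of level $k$. A filtration $\{\Gamma_i\}$ of $\Gamma$ is *nice* if for every $k\ge1$ and all but finitely many $i$ $$\mathrm{Rist}_\Gamma(k)\Gamma_i/\Gamma_i\;\cong\;\prod_{v\text{ of level }k}\mathrm{rist}_\Gamma(v)\Gamma_i/\Gamma_i .$$ **Theorem.**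 Let $G\le\mathrm{Aut}\,T_m$ be a finitely generated regular branch group, with closure $\overline G$ in $\mathrm{Aut}\,T_m$. Then there exists a natural number $b\ge2$ such that $$\mathrm{hspec}_{b}^{\mathcal S}(\overline G)=\mathrm{hspec}_{\mathrm{fg}}^{\mathcal S}(\overline G)=\mathrm{hspec}^{\mathcal S}(\overline G)=[0,1].$$ Furthermore, if $G$ is also just infinite (that is, $G$ is infinite and each of its non-trivial normal subgroups has finite index), then, with the same $b$, for every nice filtration $\mathcal N$ of $\overline G$ $$\mathrm{hspec}_{b}^{\mathcal N}(\overline G)=\mathrm{hspec}_{\mathrm{fg}}^{\mathcal N}(\overline G)=\mathrm{hspec}^{\mathcal N}(\overline G)=[0,1].$$ -/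

import Mathlib

open scoped ENNReal Topology

/-! ### The `m`-adic rooted tree and its automorphism group -/

/-- Vertices of the `m`-adic tree: finite words in an alphabet with `m` letters. The root is the
empty word and the `n`-th level consists of the words of length `n`. -/
abbrev Vertex (m : ℕ) : Type := List (Fin m)

/-- The `m`-adic tree: `u` and `v` are joined by an edge if one of them is obtained from the other
by appending one letter. -/
def mTree (m : ℕ) : SimpleGraph (Vertex m) where
  Adj u v := (∃ x : Fin m, v = u ++ [x]) ∨ (∃ x : Fin m, u = v ++ [x])
  symm := ⟨fun _ _ h => h.symm⟩
  loopless := ⟨fun u h => by rcases h with ⟨x, h⟩ | ⟨x, h⟩ <;> simp at h⟩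

/-- Bijections of the vertex set that preserve adjacency and fix the root. -/
def treeAutSubgroup (m : ℕ) : Subgroup (Equiv.Perm (Vertex m)) where
  carrier := {g | g [] = [] ∧ ∀ u v, (mTree m).Adj (g u) (g v) ↔ (mTree m).Adj u v}
  one_mem' := ⟨rfl, fun _ _ => Iff.rfl⟩
  mul_mem' := by
    rintro g h ⟨hg, hg'⟩ ⟨hh, hh'⟩
    refine ⟨by simp [hg, hh], fun u v => ?_⟩
    rw [Equiv.Perm.mul_apply, Equiv.Perm.mul_apply, hg', hh']
  inv_mem' := by
    rintro g ⟨hg, hg'⟩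
    refine ⟨by rw [Equiv.Perm.inv_eq_iff_eq, hg], fun u v => ?_⟩
    rw [← hg', show g (g⁻¹ u) = u from g.apply_symm_apply u,
      show g (g⁻¹ v) = v from g.apply_symm_apply v]

/-- The group `Aut T_m`. -/
abbrev TreeAut (m : ℕ) : Type := ↥(treeAutSubgroup m)

namespace TreeAut

variable {m : ℕ}

/-- Automorphisms of the rooted tree preserve the levels and the parent relation. -/
theorem length_and_parent (g : TreeAut m) (u : Vertex m) :
    (g.1 u).length = u.length ∧ ∀ x : Fin m, ∃ y : Fin m, g.1 (u ++ [x]) = g.1 u ++ [y] := by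
  induction u using List.reverseRecOn with
  | nil =>
    refine ⟨by rw [g.2.1], fun x => ?_⟩
    have h : (mTree m).Adj (g.1 []) (g.1 ([] ++ [x])) := (g.2.2 _ _).2 (Or.inl ⟨x, rfl⟩)
    rcases h with ⟨y, h⟩ | ⟨y, h⟩
    · exact ⟨y, h⟩
    · rw [g.2.1] at h
      simp at h
  | append_singleton u z ih =>
    obtain ⟨ihl, ihp⟩ := ih
    obtain ⟨w, hw⟩ := ihp z
    refine ⟨by rw [hw]; simp [ihl], fun x => ?_⟩
    have h : (mTree m).Adj (g.1 (u ++ [z])) (g.1 (u ++ [z] ++ [x])) :=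
      (g.2.2 _ _).2 (Or.inl ⟨x, rfl⟩)
    rcases h with ⟨y, h⟩ | ⟨y, h⟩
    · exact ⟨y, h⟩
    · rw [hw] at h
      have h1 : g.1 u = g.1 (u ++ [z] ++ [x]) := (List.append_inj' h rfl).1
      have h2 := congrArg List.length (g.1.injective h1)
      simp at h2

/-- `St(n)`: the automorphisms that fix every vertex of the `n`-th level. -/
def levelStab (m n : ℕ) : Subgroup (TreeAut m) where
  carrier := {g | ∀ u : Vertex m, u.length = n → g.1 u = u}
  one_mem' := fun _ _ => rfl
  mul_mem' := by
    intro g h hg hh u hu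
    change g.1 (h.1 u) = u
    rw [hh u hu, hg u hu]
  inv_mem' := by
    intro g hg u hu
    change g.1⁻¹ u = u
    rw [Equiv.Perm.inv_eq_iff_eq, hg u hu]

instance levelStab_normal (n : ℕ) : (levelStab m n).Normal where
  conj_mem := by
    intro g hg h u hu
    change h.1 (g.1 ((h⁻¹).1 u)) = u
    rw [hg _ (((length_and_parent h⁻¹ u).1).trans hu)]
    exact h.1.apply_symm_apply u

theorem levelStab_antitone : Antitone (levelStab m) := by
  refine antitone_nat_of_succ_le fun n g hg u hu => ?_
  rcases u with _ | ⟨x, u⟩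
  · exact g.2.1
  · obtain ⟨y, hy⟩ := (length_and_parent g (x :: u)).2 x
    rw [hg _ (by simp only [List.length_append, List.length_singleton, hu])] at hy
    exact ((List.append_inj' hy rfl).1).symm

/-- The congruence topology on `Aut T_m`: the cosets of the level stabilizers form a basis. -/
instance : TopologicalSpace (TreeAut m) where
  IsOpen U := ∀ g ∈ U, ∃ n, ∀ h, g⁻¹ * h ∈ levelStab m n → h ∈ U
  isOpen_univ := fun _ _ => ⟨0, fun _ _ => trivial⟩
  isOpen_inter := by
    rintro U V hU hV g ⟨hgU, hgV⟩
    obtain ⟨n, hn⟩ := hU g hgU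
    obtain ⟨k, hk⟩ := hV g hgV
    exact ⟨max n k, fun h hh => ⟨hn h (levelStab_antitone (le_max_left n k) hh),
      hk h (levelStab_antitone (le_max_right n k) hh)⟩⟩
  isOpen_sUnion := by
    rintro 𝒰 h𝒰 g ⟨U, hU, hgU⟩
    obtain ⟨n, hn⟩ := h𝒰 U hU g hgU
    exact ⟨n, fun h hh => ⟨U, hU, hn h hh⟩⟩

theorem isOpen_coset (g : TreeAut m) (n : ℕ) : IsOpen {h : TreeAut m | g⁻¹ * h ∈ levelStab m n} := by
  intro h hh
  refine ⟨n, fun k hk => ?_⟩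
  have := mul_mem (show g⁻¹ * h ∈ levelStab m n from hh) hk
  simpa [mul_assoc] using this

theorem isOpen_levelStab (n : ℕ) : IsOpen (levelStab m n : Set (TreeAut m)) := by
  simpa using isOpen_coset (1 : TreeAut m) n

instance : IsTopologicalGroup (TreeAut m) where
  continuous_mul := by
    refine continuous_def.2 fun U hU => isOpen_prod_iff.2 fun a b hab => ?_
    obtain ⟨n, hn⟩ := hU (a * b) hab
    refine ⟨_, _, isOpen_coset a n, isOpen_coset b n, by simp [one_mem], by simp [one_mem], ?_⟩
    rintro ⟨c, d⟩ ⟨hc, hd⟩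
    refine hn _ ?_
    have h1 : b⁻¹ * (a⁻¹ * c) * b⁻¹⁻¹ ∈ levelStab m n :=
      (levelStab_normal n).conj_mem _ hc b⁻¹
    have h2 := mul_mem h1 (show b⁻¹ * d ∈ levelStab m n from hd)
    simpa [mul_assoc] using h2
  continuous_inv := by
    refine continuous_def.2 fun U hU a ha => ?_
    obtain ⟨n, hn⟩ := hU a⁻¹ ha
    refine ⟨n, fun b hb => hn _ ?_⟩
    have h1 : a * (a⁻¹ * b)⁻¹ * a⁻¹ ∈ levelStab m n :=
      (levelStab_normal n).conj_mem _ (inv_mem hb) a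
    simpa [mul_assoc] using h1

/-! ### Regular branch groups -/

/-- `h` is the section `g|_v` of `g` at the vertex `v`: `g (v u) = g(v) h(u)` for all words `u`. The
section exists and is unique. -/
def IsSection (g : TreeAut m) (v : Vertex m) (h : TreeAut m) : Prop :=
  ∀ u : Vertex m, g.1 (v ++ u) = g.1 v ++ h.1 u

/-- All sections of elements of `G` lie in `G`. -/
def IsSelfSimilar (G : Subgroup (TreeAut m)) : Prop :=
  ∀ g ∈ G, ∀ v : Vertex m, ∃ h ∈ G, IsSection g v h

/-- `G` acts transitively on every level of the tree. -/
def IsLevelTransitive (G : Subgroup (TreeAut m)) : Prop :=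
  ∀ u v : Vertex m, u.length = v.length → ∃ g ∈ G, g.1 u = v

/-- `ψ(St_K(1)) ≥ K × ⋯ × K`: every tuple of elements of `K` is the tuple of first-level sections
of an element of `K` that fixes the first level. -/
def IsBranching (K : Subgroup (TreeAut m)) : Prop :=
  ∀ k : Fin m → TreeAut m, (∀ x, k x ∈ K) →
    ∃ g ∈ K ⊓ levelStab m 1, ∀ x : Fin m, IsSection g [x] (k x)

/-- Regular branch groups: self-similar, level-transitive, with a branching subgroup of finite
index. -/
def IsRegularBranch (G : Subgroup (TreeAut m)) : Prop :=
  IsSelfSimilar G ∧ IsLevelTransitive G ∧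
    ∃ K : Subgroup (TreeAut m), K ≤ G ∧ (K.subgroupOf G).FiniteIndex ∧ IsBranching K

end TreeAut

/-- A just infinite (discrete) group: infinite, with all proper quotients finite. -/
def IsJustInfinite (G : Type*) [Group G] : Prop :=
  Infinite G ∧ ∀ N : Subgroup G, N.Normal → N ≠ ⊥ → N.FiniteIndex

/-! ### Filtrations and Hausdorff dimension -/

/-- A filtration series of `Γ`: a descending chain `Γ = Γ_0 ≥ Γ_1 ≥ ⋯` of open normal subgroups
with trivial intersection. -/
structure FiltrationSeries (Γ : Type*) [Group Γ] [TopologicalSpace Γ] where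
  /-- The terms of the chain. -/
  seq : ℕ → Subgroup Γ
  zero_eq : seq 0 = ⊤
  anti : Antitone seq
  normal : ∀ i, (seq i).Normal
  isOpen : ∀ i, IsOpen (seq i : Set Γ)
  iInf_eq : ⨅ i, seq i = ⊥

namespace FiltrationSeries

variable {Γ : Type*} [Group Γ] [TopologicalSpace Γ]

instance (F : FiltrationSeries Γ) (i : ℕ) : (F.seq i).Normal := F.normal i

open Classical in
/-- The distance `d(x, y) = inf { |Γ : Γ_i|⁻¹ : x y⁻¹ ∈ Γ_i }`. If `Γ` is an infinite profinite
group, the infimum vanishes for `x = y`, so that the case distinction is immaterial. -/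
noncomputable def filtDist (F : FiltrationSeries Γ) (x y : Γ) : ℝ≥0∞ :=
  if x = y then 0 else ⨅ (i : ℕ) (_ : x * y⁻¹ ∈ F.seq i), ((F.seq i).index : ℝ≥0∞)⁻¹

theorem filtDist_le (F : FiltrationSeries Γ) {x y x' y' : Γ} (h : x' ≠ y')
    (H : ∀ i, x' * y'⁻¹ ∈ F.seq i → x * y⁻¹ ∈ F.seq i) : F.filtDist x y ≤ F.filtDist x' y' := by
  unfold filtDist
  rw [if_neg h]
  split_ifs
  · exact zero_le
  · exact le_iInf₂ fun i hi => iInf₂_le i (H i hi)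

/-- The metric on `Γ` induced by a filtration series. -/
@[reducible]
noncomputable def emetric (F : FiltrationSeries Γ) : EMetricSpace Γ where
  edist := F.filtDist
  edist_self := fun x => if_pos rfl
  edist_comm := by
    intro x y
    by_cases hxy : x = y
    · rw [hxy]
    · refine le_antisymm (F.filtDist_le (Ne.symm hxy) fun i hi => ?_)
        (F.filtDist_le hxy fun i hi => ?_) <;>
      · have := inv_mem hi
        simpa using this
  edist_triangle := by
    intro x y z
    by_cases hxy : x = y
    · rw [hxy]; exact le_add_self
    by_cases hyz : y = z
    · rw [hyz]; exact le_self_add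
    have key : ∀ i, x * y⁻¹ ∈ F.seq i → y * z⁻¹ ∈ F.seq i → x * z⁻¹ ∈ F.seq i := by
      intro i h1 h2
      have := mul_mem h1 h2
      simpa [mul_assoc] using this
    by_cases hs : ∀ i, x * y⁻¹ ∈ F.seq i → y * z⁻¹ ∈ F.seq i
    · exact (F.filtDist_le hxy fun i hi => key i hi (hs i hi)).trans le_self_add
    · push Not at hs
      obtain ⟨j, hj1, hj2⟩ := hs
      refine (F.filtDist_le hyz fun i hi => key i ?_ hi).trans le_add_self
      rcases le_total i j with hij | hij
      · exact F.anti hij hj1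
      · exact absurd (F.anti hij hi) hj2
  eq_of_edist_eq_zero := by
    intro x y h
    by_contra hxy
    have hne : x * y⁻¹ ∉ ⨅ i, F.seq i := by
      rw [F.iInf_eq, Subgroup.mem_bot, mul_inv_eq_one]
      exact hxy
    rw [Subgroup.mem_iInf] at hne
    push Not at hne
    obtain ⟨j, hj⟩ := hne
    change F.filtDist x y = 0 at h
    rw [filtDist, if_neg hxy] at h
    obtain ⟨i₀, -, hi₀⟩ := Finset.exists_min_image (Finset.range (j + 1))
      (fun i => ((F.seq i).index : ℝ≥0∞)⁻¹) ⟨0, by simp⟩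
    have hpos : (0 : ℝ≥0∞) < ((F.seq i₀).index : ℝ≥0∞)⁻¹ :=
      ENNReal.inv_pos.2 (ENNReal.natCast_ne_top _)
    refine absurd h (ne_of_gt (hpos.trans_le (le_iInf₂ fun i hi => hi₀ i ?_)))
    rw [Finset.mem_range]
    by_contra hij
    exact hj (F.anti (by omega) hi)

/-- The Hausdorff dimension of a subset of `Γ` with respect to the metric given by the filtration
series. -/
noncomputable def hdim (F : FiltrationSeries Γ) (s : Set Γ) : ℝ≥0∞ := @dimH Γ F.emetric s

/-- The Hausdorff spectrum of `Γ` restricted to the closed subgroups with the property `P`. -/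
def hspecOf (F : FiltrationSeries Γ) (P : Subgroup Γ → Prop) : Set ℝ≥0∞ :=
  {d | ∃ H : Subgroup Γ, IsClosed (H : Set Γ) ∧ P H ∧ F.hdim (H : Set Γ) = d}

/-- The Hausdorff spectrum. -/
def hspec (F : FiltrationSeries Γ) : Set ℝ≥0∞ := F.hspecOf fun _ => True

/-- The finitely generated Hausdorff spectrum, given by the closed subgroups that are topologically
generated by finitely many elements. -/
def hspecFG (F : FiltrationSeries Γ) : Set ℝ≥0∞ :=
  F.hspecOf fun H => ∃ S : Finset Γ, closure (Subgroup.closure (S : Set Γ) : Set Γ) = (H : Set Γ)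

/-- The `b`-bounded Hausdorff spectrum, given by the closed subgroups that are topologically
generated by at most `b` elements. -/
def hspecBounded (F : FiltrationSeries Γ) (b : ℕ) : Set ℝ≥0∞ :=
  F.hspecOf fun H =>
    ∃ S : Finset Γ, S.card ≤ b ∧ closure (Subgroup.closure (S : Set Γ) : Set Γ) = (H : Set Γ)

end FiltrationSeries

namespace TreeAut

variable {m : ℕ}

/-- The filtration of `Γ ≤ Aut T_m` by its level stabilizers `St_Γ(n) = St(n) ∩ Γ`. -/
def levelStabFiltration (Γ : Subgroup (TreeAut m)) : FiltrationSeries Γ where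
  seq n := (levelStab m n).subgroupOf Γ
  zero_eq := by
    refine eq_top_iff.2 fun g _ u hu => ?_
    rw [List.length_eq_zero_iff.1 hu]
    exact g.1.2.1
  anti := fun _ _ h _ hg => levelStab_antitone h hg
  normal := fun _ => inferInstance
  isOpen := fun n => (isOpen_levelStab n).preimage continuous_subtype_val
  iInf_eq := by
    refine eq_bot_iff.2 fun g hg => ?_
    rw [Subgroup.mem_iInf] at hg
    rw [Subgroup.mem_bot]
    refine Subtype.ext (Subtype.ext (Equiv.ext fun u => ?_))
    exact hg u.length u rfl

/-- The rigid vertex stabilizer `rist_Γ(v)`: the elements of `Γ` that fix `v` and act trivially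
outside the subtree rooted at `v`. -/
def rist (Γ : Subgroup (TreeAut m)) (v : Vertex m) : Subgroup Γ where
  carrier := {g | g.1.1 v = v ∧ ∀ u : Vertex m, ¬ v <+: u → g.1.1 u = u}
  one_mem' := ⟨rfl, fun _ _ => rfl⟩
  mul_mem' := by
    rintro g h ⟨hg, hg'⟩ ⟨hh, hh'⟩
    refine ⟨?_, fun u hu => ?_⟩
    · change g.1.1 (h.1.1 v) = v
      rw [hh, hg]
    · change g.1.1 (h.1.1 u) = u
      rw [hh' u hu, hg' u hu]
  inv_mem' := by
    rintro g ⟨hg, hg'⟩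
    refine ⟨?_, fun u hu => ?_⟩
    · change g.1.1⁻¹ v = v
      rw [Equiv.Perm.inv_eq_iff_eq, hg]
    · change g.1.1⁻¹ u = u
      rw [Equiv.Perm.inv_eq_iff_eq, hg' u hu]

/-- The rigid level stabilizer `Rist_Γ(n)`: the product of the (pairwise commuting) rigid vertex
stabilizers of the vertices of level `n`. -/
def levelRist (Γ : Subgroup (TreeAut m)) (n : ℕ) : Subgroup Γ :=
  ⨆ v : {v : Vertex m // v.length = n}, rist Γ v.1

/-- A filtration series `(Γ_i)` of `Γ` is nice if for every `k ≥ 1` and almost all `i` the group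
`Rist_Γ(k) Γ_i / Γ_i` is isomorphic to the direct product of the groups `rist_Γ(v) Γ_i / Γ_i`, where
`v` runs through the vertices of level `k`. Here `A Γ_i / Γ_i` is the image of `A` in `Γ / Γ_i`. -/
def IsNice (Γ : Subgroup (TreeAut m)) (F : FiltrationSeries Γ) : Prop :=
  ∀ k : ℕ, 1 ≤ k → ∀ᶠ i in Filter.atTop,
    Nonempty (↥((levelRist Γ k).map (QuotientGroup.mk' (F.seq i))) ≃*
      ((v : {v : Vertex m // v.length = k}) → ↥((rist Γ v.1).map (QuotientGroup.mk' (F.seq i)))))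

end TreeAut

/-! Let K be a normal branching subgroup of finite index in G; the normal core of any branching
subgroup will do (`IsRegularBranch.exists_isNormalBranch`). Read words as m-adic subintervals of [0,
1]. For α in [0, 1] the maximal such intervals inside [0, α] form a prefix-free, possibly infinite,
set V of vertices. A subgroup H of dimension α is generated topologically by copies of K spread over
V: the diagonal copy and, for each t in a finite set of coset representatives of K in G, the copy
that puts k below every v in V at the vertex t(v). As K is finitely generated, the number of
generators is bounded independently of α; hence one b serves all dimensions.

The shifted copies isolate single components. For v ≠ v' in V the vertices t(v) and t(v') are
incomparable, so the commutator of a t-shifted element with a diagonal element supported at t(v)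
survives only below v. Conjugating by diagonal elements and using transitivity of G, one finds in H
copies of [K, K] at all vertices w below v with |w| ≥ 2|v| (`place_commutator_mem`).

This squeezes the size of H (`HasDensity`). At level k it acts trivially below all but about α m^k
vertices, so a subgroup of finite index in it lies in the product of that many rigid stabilizers. At
level 2j it contains copies of [K, K] at about α m^(2j) vertices. Rigid stabilizers of one level are
conjugate and, modulo almost all terms of the filtration, independent, so each takes the share
m^(-k) of log |Γ : Γ_i| in the limit (`tendsto_log_relIndex_rist`). Bounds on log |H : H ∩ Γ_i| /
log |Γ : Γ_i| become bounds on the dimension by `FiltrationSeries.hdim_le` and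
`FiltrationSeries.le_hdim`.

It remains that copies of [K, K] are asymptotically as large as the rigid stabilizers (`IsFull`). If
G is just infinite, [K, K] is a nontrivial normal subgroup and so has finite index. For the level
stabilizers, passing from K to [K, K] loses only O(n) in the logarithm, because K is finitely
generated, whereas log |Γ : St(n) ∩ Γ| grows faster than linearly (`isFull_levelStabFiltration`). -/

namespace TreeAut

variable {m : ℕ}

/-! ### Sections and grafting -/

theorem ext_apply {g h : TreeAut m} (H : ∀ u, g.1 u = h.1 u) : g = h :=
  Subtype.ext (Equiv.ext H)

theorem mul_apply (g h : TreeAut m) (u : Vertex m) : (g * h).1 u = g.1 (h.1 u) := rfl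

theorem one_apply (u : Vertex m) : (1 : TreeAut m).1 u = u := rfl

theorem inv_apply_self (g : TreeAut m) (u : Vertex m) : (g⁻¹).1 (g.1 u) = u :=
  g.1.symm_apply_apply u

theorem apply_inv_self (g : TreeAut m) (u : Vertex m) : g.1 ((g⁻¹).1 u) = u :=
  g.1.apply_symm_apply u

theorem length_apply (g : TreeAut m) (u : Vertex m) : (g.1 u).length = u.length :=
  (length_and_parent g u).1

theorem apply_prefix_append (g : TreeAut m) (u w : Vertex m) : g.1 u <+: g.1 (u ++ w) := by
  induction w using List.reverseRecOn with
  | nil => simp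
  | append_singleton w x ih =>
    obtain ⟨y, hy⟩ := (length_and_parent g (u ++ w)).2 x
    rw [← List.append_assoc, hy]
    exact ih.trans (List.prefix_append _ _)

theorem apply_prefix (g : TreeAut m) {u v : Vertex m} (h : u <+: v) : g.1 u <+: g.1 v := by
  obtain ⟨w, rfl⟩ := h
  exact apply_prefix_append g u w

theorem apply_prefix_iff (g : TreeAut m) {u v : Vertex m} : g.1 u <+: g.1 v ↔ u <+: v := by
  refine ⟨fun h => ?_, apply_prefix g⟩
  have := apply_prefix g⁻¹ h
  rwa [inv_apply_self, inv_apply_self] at this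

theorem apply_append_drop (g : TreeAut m) (v u : Vertex m) :
    g.1 v ++ (g.1 (v ++ u)).drop v.length = g.1 (v ++ u) := by
  obtain ⟨w, hw⟩ := apply_prefix_append g v u
  rw [← hw, ← length_apply g v, List.drop_left]

/-- Maps of the vertex set that fix the root and send children of `u` to children of the image
of `u`. -/
def PreservesChildren (f : Vertex m → Vertex m) : Prop :=
  f [] = [] ∧ ∀ u x, ∃ y, f (u ++ [x]) = f u ++ [y]

theorem PreservesChildren.adj {f : Vertex m → Vertex m} (hf : PreservesChildren f) {u v : Vertex m}
    (h : (mTree m).Adj u v) : (mTree m).Adj (f u) (f v) := by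
  rcases h with ⟨x, rfl⟩ | ⟨x, rfl⟩
  · exact Or.inl (hf.2 u x)
  · exact Or.inr (hf.2 v x)

/-- The tree automorphism given by two mutually inverse maps that preserve children. -/
def ofMaps (f f' : Vertex m → Vertex m) (hf : PreservesChildren f) (hf' : PreservesChildren f')
    (hl : Function.LeftInverse f' f) (hr : Function.RightInverse f' f) : TreeAut m :=
  ⟨⟨f, f', hl, hr⟩, hf.1, fun u v => ⟨fun h => by
    have : (mTree m).Adj (f' (f u)) (f' (f v)) := hf'.adj h
    rwa [hl u, hl v] at this, fun h => hf.adj h⟩⟩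

theorem preservesChildren_drop (g : TreeAut m) (v w : Vertex m) (h : g.1 v = w) :
    PreservesChildren fun u => (g.1 (v ++ u)).drop w.length := by
  subst h
  refine ⟨by simp, fun u x => ?_⟩
  obtain ⟨y, hy⟩ := (length_and_parent g (v ++ u)).2 x
  refine ⟨y, ?_⟩
  simp only
  rw [← List.append_assoc, hy, List.drop_append_of_le_length]
  simp [length_apply]

/-- The section `g|_v`. -/
def sec (g : TreeAut m) (v : Vertex m) : TreeAut m :=
  ofMaps (fun u => (g.1 (v ++ u)).drop v.length) (fun u => ((g⁻¹).1 (g.1 v ++ u)).drop v.length)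
    (by
      have := preservesChildren_drop g v _ rfl
      rwa [length_apply] at this)
    (preservesChildren_drop g⁻¹ (g.1 v) v (inv_apply_self g v))
    (fun u => by
      simp only
      rw [apply_append_drop, inv_apply_self, List.drop_left])
    (fun u => by
      have h := apply_append_drop g⁻¹ (g.1 v) u
      rw [inv_apply_self, length_apply] at h
      simp only
      rw [h, apply_inv_self, ← length_apply g v, List.drop_left])

theorem apply_append (g : TreeAut m) (v u : Vertex m) :
    g.1 (v ++ u) = g.1 v ++ (sec g v).1 u :=
  (apply_append_drop g v u).symm

theorem IsSection.eq_sec {g h : TreeAut m} {v : Vertex m} (H : IsSection g v h) : h = sec g v :=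
  ext_apply fun u => List.append_cancel_left ((H u).symm.trans (apply_append g v u))

/-- No word of `V` is a proper prefix of another one. -/
def PrefixFree (V : Set (Vertex m)) : Prop :=
  ∀ ⦃v⦄, v ∈ V → ∀ ⦃w⦄, w ∈ V → v <+: w → v = w

theorem PrefixFree.eq_of_prefix {V : Set (Vertex m)} (hV : PrefixFree V) {v w u : Vertex m}
    (hv : v ∈ V) (hw : w ∈ V) (hvu : v <+: u) (hwu : w <+: u) : v = w := by
  rcases List.prefix_or_prefix_of_prefix hvu hwu with h | h
  · exact hV hv hw h
  · exact (hV hw hv h).symm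

theorem PrefixFree.mono {V W : Set (Vertex m)} (hV : PrefixFree V) (h : W ⊆ V) : PrefixFree W :=
  fun _ hv _ hw => hV (h hv) (h hw)

theorem prefixFree_singleton (w : Vertex m) : PrefixFree {w} := by
  rintro _ rfl _ rfl _
  rfl

theorem prefixFree_of_length {V : Set (Vertex m)} {k : ℕ} (h : ∀ v ∈ V, v.length = k) :
    PrefixFree V := fun _ hv _ hw hvw => hvw.eq_of_length ((h _ hv).trans (h _ hw).symm)

open Classical in
/-- The map that acts as `s v` below each vertex `v` of `V`, and trivially elsewhere. -/
noncomputable def graftFun (V : Set (Vertex m)) (s : Vertex m → TreeAut m) (u : Vertex m) :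
    Vertex m :=
  if h : ∃ v ∈ V, v <+: u then h.choose ++ (s h.choose).1 (u.drop h.choose.length) else u

theorem graftFun_append {V : Set (Vertex m)} (hV : PrefixFree V) (s : Vertex m → TreeAut m)
    {v : Vertex m} (hv : v ∈ V) (u : Vertex m) : graftFun V s (v ++ u) = v ++ (s v).1 u := by
  have h : ∃ w ∈ V, w <+: v ++ u := ⟨v, hv, List.prefix_append _ _⟩
  have h1 : h.choose = v :=
    hV.eq_of_prefix h.choose_spec.1 hv h.choose_spec.2 (List.prefix_append _ _)
  rw [graftFun, dif_pos h, h1, List.drop_left]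

theorem graftFun_of_not {V : Set (Vertex m)} (s : Vertex m → TreeAut m) {u : Vertex m}
    (h : ¬ ∃ v ∈ V, v <+: u) : graftFun V s u = u := dif_neg h

theorem preservesChildren_graftFun {V : Set (Vertex m)} (hV : PrefixFree V)
    (s : Vertex m → TreeAut m) : PreservesChildren (graftFun V s) := by
  constructor
  · by_cases h : ∃ v ∈ V, v <+: ([] : Vertex m)
    · obtain ⟨v, hv, hv'⟩ := h
      obtain rfl := List.prefix_nil.1 hv'
      have := graftFun_append hV s hv []
      simpa [(s []).2.1] using this
    · exact graftFun_of_not s h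
  · intro u x
    by_cases h : ∃ v ∈ V, v <+: u
    · obtain ⟨v, hv, w, rfl⟩ := h
      obtain ⟨y, hy⟩ := (length_and_parent (s v) w).2 x
      refine ⟨y, ?_⟩
      rw [List.append_assoc, graftFun_append hV s hv, graftFun_append hV s hv, hy,
        List.append_assoc]
    · refine ⟨x, ?_⟩
      rw [graftFun_of_not s h]
      by_cases h' : ∃ v ∈ V, v <+: u ++ [x]
      · obtain ⟨v, hv, hv'⟩ := h'
        rcases List.prefix_concat_iff.1 hv' with rfl | h1
        · have := graftFun_append hV s hv []
          simpa [(s _).2.1] using this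
        · exact absurd ⟨v, hv, h1⟩ h
      · exact graftFun_of_not s h'

theorem graftFun_comp {V : Set (Vertex m)} (hV : PrefixFree V) (s t : Vertex m → TreeAut m)
    (u : Vertex m) : graftFun V s (graftFun V t u) = graftFun V (s * t) u := by
  by_cases h : ∃ v ∈ V, v <+: u
  · obtain ⟨v, hv, w, rfl⟩ := h
    simp only [graftFun_append hV _ hv]
    rfl
  · rw [graftFun_of_not t h, graftFun_of_not s h, graftFun_of_not _ h]

theorem graftFun_one {V : Set (Vertex m)} (hV : PrefixFree V) (u : Vertex m) :
    graftFun V 1 u = u := by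
  by_cases h : ∃ v ∈ V, v <+: u
  · obtain ⟨v, hv, w, rfl⟩ := h
    rw [graftFun_append hV _ hv]
    rfl
  · exact graftFun_of_not _ h

/-- The homomorphism that sends a family `s` of automorphisms to the automorphism acting as `s v`
below each vertex `v` of `V`, and trivially elsewhere. -/
noncomputable def graft {V : Set (Vertex m)} (hV : PrefixFree V) :
    (Vertex m → TreeAut m) →* TreeAut m where
  toFun s := ofMaps (graftFun V s) (graftFun V s⁻¹) (preservesChildren_graftFun hV s)
    (preservesChildren_graftFun hV s⁻¹)
    (fun u => by rw [graftFun_comp hV, inv_mul_cancel, graftFun_one hV])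
    (fun u => by rw [graftFun_comp hV, mul_inv_cancel, graftFun_one hV])
  map_one' := ext_apply fun u => graftFun_one hV u
  map_mul' s t := ext_apply fun u => (graftFun_comp hV s t u).symm

theorem graft_apply_append {V : Set (Vertex m)} (hV : PrefixFree V) (s : Vertex m → TreeAut m)
    {v : Vertex m} (hv : v ∈ V) (u : Vertex m) : (graft hV s).1 (v ++ u) = v ++ (s v).1 u :=
  graftFun_append hV s hv u

theorem graft_apply_of_not {V : Set (Vertex m)} (hV : PrefixFree V) (s : Vertex m → TreeAut m)
    {u : Vertex m} (h : ¬ ∃ v ∈ V, v <+: u) : (graft hV s).1 u = u :=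
  graftFun_of_not s h

theorem graft_congr {V : Set (Vertex m)} (hV : PrefixFree V) {s t : Vertex m → TreeAut m}
    (h : ∀ v ∈ V, s v = t v) : graft hV s = graft hV t := by
  refine ext_apply fun u => ?_
  by_cases hu : ∃ v ∈ V, v <+: u
  · obtain ⟨v, hv, w, rfl⟩ := hu
    rw [graft_apply_append hV s hv, graft_apply_append hV t hv, h v hv]
  · rw [graft_apply_of_not hV s hu, graft_apply_of_not hV t hu]

/-- The homomorphism that sends `g` to the automorphism acting as `g` below the vertex `w`, and
trivially elsewhere. -/
noncomputable def place (w : Vertex m) : TreeAut m →* TreeAut m where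
  toFun g := graft (prefixFree_singleton w) fun _ => g
  map_one' := (graft (prefixFree_singleton w)).map_one
  map_mul' g h := (graft (prefixFree_singleton w)).map_mul (fun _ => g) fun _ => h

theorem place_apply_append (w : Vertex m) (g : TreeAut m) (u : Vertex m) :
    (place w g).1 (w ++ u) = w ++ g.1 u :=
  graft_apply_append (prefixFree_singleton w) (fun _ => g) rfl u

theorem place_apply_of_not {w : Vertex m} (g : TreeAut m) {u : Vertex m} (h : ¬ w <+: u) :
    (place w g).1 u = u :=
  graft_apply_of_not (prefixFree_singleton w) (fun _ => g) (by simpa using h)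

theorem place_apply_self (w : Vertex m) (g : TreeAut m) : (place w g).1 w = w := by
  have := place_apply_append w g []
  rwa [g.2.1, List.append_nil] at this

theorem place_injective (w : Vertex m) : Function.Injective (place w) := by
  intro g h H
  refine ext_apply fun u => ?_
  have := place_apply_append w g u
  rw [H, place_apply_append] at this
  exact (List.append_cancel_left this).symm

theorem place_append (v w : Vertex m) (g : TreeAut m) :
    place (v ++ w) g = place v (place w g) := by
  refine ext_apply fun u => ?_
  by_cases hv : v <+: u
  · obtain ⟨u, rfl⟩ := hv
    rw [place_apply_append]
    by_cases hw : w <+: u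
    · obtain ⟨u, rfl⟩ := hw
      rw [place_apply_append, ← List.append_assoc, place_apply_append, List.append_assoc]
    · rw [place_apply_of_not _ hw, place_apply_of_not]
      rwa [List.prefix_append_right_inj]
  · rw [place_apply_of_not _ hv, place_apply_of_not]
    exact fun h => hv ((List.prefix_append v w).trans h)

/-- Conjugation transports the support and twists the content by a section. The twist is harmless
for K and [K, K], which are normalized by the self-similar group G. -/
theorem conj_place (g h : TreeAut m) (w : Vertex m) :
    g * place w h * g⁻¹ = place (g.1 w) (sec g w * h * (sec g w)⁻¹) := by
  rw [mul_inv_eq_iff_eq_mul]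
  refine ext_apply fun u => ?_
  rw [mul_apply, mul_apply]
  by_cases hw : w <+: u
  · obtain ⟨u, rfl⟩ := hw
    rw [place_apply_append, apply_append, apply_append g w u, place_apply_append, mul_apply,
      mul_apply, inv_apply_self]
  · rw [place_apply_of_not _ hw, place_apply_of_not]
    rwa [apply_prefix_iff]

/-- `g` fixes `w` and acts trivially outside the subtree rooted at `w`. -/
def SupportedAt (w : Vertex m) (g : TreeAut m) : Prop :=
  g.1 w = w ∧ ∀ u : Vertex m, ¬ w <+: u → g.1 u = u

theorem supportedAt_place (w : Vertex m) (g : TreeAut m) : SupportedAt w (place w g) :=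
  ⟨place_apply_self w g, fun _ h => place_apply_of_not g h⟩

theorem SupportedAt.eq_place {w : Vertex m} {g : TreeAut m} (h : SupportedAt w g) :
    g = place w (sec g w) := by
  refine ext_apply fun u => ?_
  by_cases hw : w <+: u
  · obtain ⟨u, rfl⟩ := hw
    rw [place_apply_append, apply_append, h.1]
  · rw [place_apply_of_not _ hw, h.2 u hw]

theorem SupportedAt.commute {v w : Vertex m} {g h : TreeAut m} (hg : SupportedAt v g)
    (hh : SupportedAt w h) (h1 : ¬ v <+: w) (h2 : ¬ w <+: v) : Commute g h := by
  -- The subtree at v is preserved by g and disjoint from the subtree at w, so h is trivial on it.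
  have key : ∀ {v w : Vertex m} {g h : TreeAut m}, SupportedAt v g → SupportedAt w h →
      ¬ v <+: w → ¬ w <+: v → ∀ u, v <+: u → g.1 (h.1 u) = h.1 (g.1 u) := by
    intro v w g h hg hh h1 h2 u hu
    have h3 : ∀ u, v <+: u → ¬ w <+: u := fun u hu hw =>
      (List.prefix_or_prefix_of_prefix hu hw).elim h1 h2
    have h4 : v <+: g.1 u := by
      have := apply_prefix g hu
      rwa [hg.1] at this
    rw [hh.2 u (h3 u hu), hh.2 _ (h3 _ h4)]
  refine ext_apply fun u => ?_
  rw [mul_apply, mul_apply]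
  by_cases hv : v <+: u
  · exact key hg hh h1 h2 u hv
  by_cases hw : w <+: u
  · exact (key hh hg h2 h1 u hw).symm
  rw [hg.2 u hv, hh.2 u hw, hg.2 u hv]

theorem place_mem_levelStab {w : Vertex m} {g : TreeAut m} {n : ℕ} :
    place w g ∈ levelStab m (w.length + n) ↔ g ∈ levelStab m n := by
  constructor
  · intro h u hu
    have := h (w ++ u) (by rw [List.length_append, hu])
    rw [place_apply_append] at this
    exact List.append_cancel_left this
  · intro h u hu
    by_cases hw : w <+: u
    · obtain ⟨u, rfl⟩ := hw
      rw [place_apply_append, h u (by rw [List.length_append] at hu; omega)]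
    · exact place_apply_of_not g hw

theorem sec_mem_levelStab {g : TreeAut m} {k n : ℕ} (hg : g ∈ levelStab m (k + n)) {w : Vertex m}
    (hw : w.length = k) : sec g w ∈ levelStab m n := by
  intro u hu
  have h1 := hg (w ++ u) (by rw [List.length_append, hw, hu])
  rw [apply_append, levelStab_antitone (Nat.le_add_right k n) hg w hw] at h1
  exact List.append_cancel_left h1

end TreeAut

/-! ### Finite index and closures -/

theorem Subgroup.exists_finset_cover_of_relIndex_ne_zero {A : Type*} [Group A] {K G : Subgroup A}
    (h : K.relIndex G ≠ 0) :
    ∃ T : Finset A, (∀ t ∈ T, t ∈ G) ∧ ∀ g ∈ G, ∃ t ∈ T, t⁻¹ * g ∈ K := by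
  classical
  have : Finite (G ⧸ K.subgroupOf G) := Nat.finite_of_card_ne_zero h
  have := Fintype.ofFinite (G ⧸ K.subgroupOf G)
  refine ⟨Finset.univ.image fun q : G ⧸ K.subgroupOf G => (q.out : A), ?_, fun g hg => ?_⟩
  · intro t ht
    obtain ⟨q, -, rfl⟩ := Finset.mem_image.1 ht
    exact q.out.2
  · refine ⟨_, Finset.mem_image_of_mem _ (Finset.mem_univ (QuotientGroup.mk (⟨g, hg⟩ : G))), ?_⟩
    have := QuotientGroup.eq.1 (QuotientGroup.out_eq' (QuotientGroup.mk (s := K.subgroupOf G)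
      (⟨g, hg⟩ : G)))
    exact this

/-- Finitely many translates of K cover G; the same translates of the closure of K form a closed
set, which therefore contains the closure of G. -/
theorem Subgroup.relIndex_topologicalClosure_ne_zero {A : Type*} [Group A] [TopologicalSpace A]
    [IsTopologicalGroup A] {K G : Subgroup A} (h : K.relIndex G ≠ 0) :
    K.topologicalClosure.relIndex G.topologicalClosure ≠ 0 := by
  obtain ⟨T, hTG, hT⟩ := Subgroup.exists_finset_cover_of_relIndex_ne_zero h
  have hcl : IsClosed (⋃ t ∈ T, {g : A | t⁻¹ * g ∈ K.topologicalClosure}) :=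
    T.finite_toSet.isClosed_biUnion fun t _ =>
      K.isClosed_topologicalClosure.preimage (continuous_const_mul t⁻¹)
  have hsub : (G.topologicalClosure : Set A) ⊆ ⋃ t ∈ T, {g : A | t⁻¹ * g ∈ K.topologicalClosure} := by
    refine closure_minimal (fun g hg => ?_) hcl
    obtain ⟨t, ht, h1⟩ := hT g hg
    exact Set.mem_biUnion ht (K.le_topologicalClosure h1)
  have : Finite (G.topologicalClosure ⧸ K.topologicalClosure.subgroupOf G.topologicalClosure) := by
    refine Finite.of_surjective (fun t : T => QuotientGroup.mk
      (⟨t.1, G.le_topologicalClosure (hTG t.1 t.2)⟩ : G.topologicalClosure)) fun q => ?_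
    obtain ⟨g, rfl⟩ := QuotientGroup.mk_surjective q
    obtain ⟨t, ht, h1⟩ := Set.mem_iUnion₂.1 (hsub g.2)
    exact ⟨⟨t, ht⟩, QuotientGroup.eq.2 h1⟩
  exact Nat.card_pos.ne'

namespace TreeAut

variable {m : ℕ}

/-! ### The congruence topology -/

theorem inv_mul_mem_levelStab_iff {g h : TreeAut m} {n : ℕ} :
    g⁻¹ * h ∈ levelStab m n ↔ ∀ u : Vertex m, u.length = n → h.1 u = g.1 u := by
  refine forall₂_congr fun u _ => ?_
  rw [mul_apply]
  constructor
  · intro H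
    rw [← apply_inv_self g (h.1 u), H]
  · intro H
    rw [H, inv_apply_self]

theorem apply_eq_of_le {g h : TreeAut m} {n : ℕ} (H : ∀ u : Vertex m, u.length = n → h.1 u = g.1 u)
    {u : Vertex m} (hu : u.length ≤ n) : h.1 u = g.1 u :=
  inv_mul_mem_levelStab_iff.1 (levelStab_antitone hu (inv_mul_mem_levelStab_iff.2 H)) u rfl

theorem mem_closure_iff {s : Set (TreeAut m)} {g : TreeAut m} :
    g ∈ closure s ↔ ∀ n, ∃ h ∈ s, ∀ u : Vertex m, u.length = n → h.1 u = g.1 u := by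
  constructor
  · intro hg n
    obtain ⟨h, h1, h2⟩ := _root_.mem_closure_iff.1 hg _ (isOpen_coset g n) (by simp [one_mem])
    exact ⟨h, h2, inv_mul_mem_levelStab_iff.1 h1⟩
  · intro H
    refine _root_.mem_closure_iff.2 fun U hU hgU => ?_
    obtain ⟨n, hn⟩ := hU g hgU
    obtain ⟨h, h1, h2⟩ := H n
    exact ⟨h, hn h (inv_mul_mem_levelStab_iff.2 h2), h1⟩

theorem mem_topologicalClosure_iff {G : Subgroup (TreeAut m)} {g : TreeAut m} :
    g ∈ G.topologicalClosure ↔ ∀ n, ∃ h ∈ G, ∀ u : Vertex m, u.length = n → h.1 u = g.1 u :=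
  mem_closure_iff

theorem continuous_place (w : Vertex m) : Continuous (place w) := by
  refine continuous_def.2 fun U hU g hg => ?_
  obtain ⟨n, hn⟩ := hU _ hg
  refine ⟨n, fun h hh => hn _ ?_⟩
  rw [← map_inv, ← map_mul]
  exact levelStab_antitone (Nat.le_add_left n w.length) (place_mem_levelStab.2 hh)

theorem isClosed_fixing (u : Vertex m) : IsClosed {g : TreeAut m | g.1 u = u} := by
  rw [← closure_subset_iff_isClosed]
  intro g hg
  obtain ⟨h, h1, h2⟩ := mem_closure_iff.1 hg u.length
  exact (h2 u rfl).symm.trans h1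

/-- There are finitely many candidates for the image of u, namely the words of its length, so the
ultrafilter selects one. -/
theorem exists_eventually_apply_eq (f : Ultrafilter (TreeAut m)) (φ : TreeAut m → TreeAut m)
    (u : Vertex m) : ∃ w : Vertex m, ∀ᶠ g in (f : Filter (TreeAut m)), (φ g).1 u = w := by
  have h := (Ultrafilter.finite_biUnion_mem_iff (f := f)
    (s := fun w : Vertex m => {g : TreeAut m | (φ g).1 u = w})
    (List.finite_length_eq (Fin m) u.length)).1 (Filter.mem_of_superset Filter.univ_mem fun g _ => by
      exact Set.mem_biUnion (length_apply (φ g) u) rfl)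
  obtain ⟨w, -, hw⟩ := h
  exact ⟨w, hw⟩

/-- The pointwise limits of g and of g⁻¹ along an ultrafilter exist, are mutually inverse and
preserve children; they define the limit automorphism. -/
instance : CompactSpace (TreeAut m) := by
  refine ⟨isCompact_iff_ultrafilter_le_nhds.2 fun f _ => ?_⟩
  choose φ hφ using exists_eventually_apply_eq f id
  choose ψ hψ using exists_eventually_apply_eq f fun g => g⁻¹
  have pres : ∀ (σ : TreeAut m → TreeAut m) (χ : Vertex m → Vertex m),
      (∀ u, ∀ᶠ g in (f : Filter (TreeAut m)), (σ g).1 u = χ u) → PreservesChildren χ := by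
    intro σ χ h
    refine ⟨?_, fun u x => ?_⟩
    · obtain ⟨g, hg⟩ := (h []).exists
      rw [← hg, (σ g).2.1]
    · obtain ⟨g, hg, hg'⟩ := ((h u).and (h (u ++ [x]))).exists
      rw [← hg, ← hg']
      exact (length_and_parent (σ g) u).2 x
  let g₀ : TreeAut m := ofMaps φ ψ (pres _ _ hφ) (pres _ _ hψ)
    (fun u => by
      obtain ⟨g, hg, hg'⟩ := ((hφ u).and (hψ (φ u))).exists
      rw [← hg', ← hg]
      exact inv_apply_self g u)
    (fun u => by
      obtain ⟨g, hg, hg'⟩ := ((hψ u).and (hφ (ψ u))).exists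
      rw [← hg', ← hg]
      exact apply_inv_self g u)
  refine ⟨g₀, trivial, fun U hU => ?_⟩
  obtain ⟨W, hWU, hW, hgW⟩ := mem_nhds_iff.1 hU
  obtain ⟨n, hn⟩ := hW g₀ hgW
  have h1 : ∀ᶠ g in (f : Filter (TreeAut m)), ∀ u ∈ {u : Vertex m | u.length = n}, g.1 u = φ u :=
    (List.finite_length_eq (Fin m) n).eventually_all.2 fun u _ => hφ u
  exact h1.mono fun g hg => hWU (hn g (inv_mul_mem_levelStab_iff.2 hg))

end TreeAut

/-! ### Hausdorff dimension of closed subgroups from relative indices -/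

section HausdorffDimension

open MeasureTheory Metric Filter
open scoped Pointwise

/-- A uniform lower bound for the `d`-dimensional size of all fine covers of a set bounds its
Hausdorff dimension from below. -/
theorem le_dimH_of_forall_cover {X : Type*} [EMetricSpace X] {s : Set X} {d : NNReal} {c r : ℝ≥0∞}
    (hc : 0 < c) (hr : 0 < r) (h : ∀ t : ℕ → Set X, s ⊆ ⋃ n, t n → (∀ n, ediam (t n) ≤ r) →
      c ≤ ∑' n, ⨆ _ : (t n).Nonempty, ediam (t n) ^ (d : ℝ)) : (d : ℝ≥0∞) ≤ dimH s := by
  borelize X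
  refine le_dimH_of_hausdorffMeasure_ne_zero (ne_of_gt (hc.trans_le ?_))
  rw [Measure.hausdorffMeasure_apply]
  refine le_iSup₂_of_le r hr ?_
  exact le_iInf fun t => le_iInf₂ fun h1 h2 => h t h1 h2

/-- If a set has covers by `N i` sets of diameter at most `δ i` with `δ i → 0` and `N i * δ i ^ d`
bounded, then it has Hausdorff dimension at most `d`. -/
theorem dimH_le_of_cover {X : Type*} [EMetricSpace X] {s : Set X} {d : NNReal}
    {δ : ℕ → ℝ≥0∞} (hδ : Tendsto δ atTop (𝓝 0)) {ι : ℕ → Type*} [∀ n, Fintype (ι n)]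
    (t : ∀ n, ι n → Set X) (ht : ∀ n i, ediam (t n i) ≤ δ n) (hst : ∀ n, s ⊆ ⋃ i, t n i)
    (h : ∀ᶠ n in atTop, (Fintype.card (ι n) : ℝ≥0∞) * δ n ^ (d : ℝ) ≤ 1) :
    dimH s ≤ d := by
  borelize X
  refine dimH_le_of_hausdorffMeasure_ne_top (ne_top_of_le_ne_top ENNReal.one_ne_top ?_)
  refine (Measure.hausdorffMeasure_le_liminf_sum _ s δ hδ t (Eventually.of_forall ht)
    (Eventually.of_forall hst)).trans ?_
  refine liminf_le_of_frequently_le' (Eventually.frequently (h.mono fun n hn => ?_))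
  refine le_trans (Finset.sum_le_card_nsmul _ _ (δ n ^ (d : ℝ)) fun i _ => ?_) ?_
  · exact ENNReal.rpow_le_rpow (ht n i) d.2
  · simpa [nsmul_eq_mul] using hn

namespace FiltrationSeries

variable {Γ : Type*} [Group Γ] [TopologicalSpace Γ]

theorem filtDist_le_of_mem (F : FiltrationSeries Γ) {x y : Γ} {i : ℕ} (h : x * y⁻¹ ∈ F.seq i) :
    F.filtDist x y ≤ ((F.seq i).index : ℝ≥0∞)⁻¹ := by
  unfold filtDist
  split_ifs
  · exact zero_le
  · exact iInf₂_le i h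

theorem index_mono (F : FiltrationSeries Γ) (hF : ∀ i, (F.seq i).index ≠ 0) :
    Monotone fun i => (F.seq i).index :=
  fun _ j hij => Nat.le_of_dvd (Nat.pos_of_ne_zero (hF j)) (Subgroup.index_dvd_of_le (F.anti hij))

/-- The shift from i + 1 to i matters: missing Γ_(i+1) leaves only terms of number at most i in the
infimum. -/
theorem le_filtDist_of_notMem (F : FiltrationSeries Γ) (hF : ∀ i, (F.seq i).index ≠ 0) {x y : Γ}
    {i : ℕ} (h : x * y⁻¹ ∉ F.seq (i + 1)) : ((F.seq i).index : ℝ≥0∞)⁻¹ ≤ F.filtDist x y := by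
  have hxy : x ≠ y := by
    rintro rfl
    exact h (by simp [one_mem])
  unfold filtDist
  rw [if_neg hxy]
  refine le_iInf₂ fun j hj => ENNReal.inv_le_inv.2 (Nat.cast_le.2 (F.index_mono hF ?_))
  by_contra hij
  exact h (F.anti (by omega) hj)

/-- Bounded indices would make the chain stationary, so the trivial group would be a term of it and
have finite index. -/
theorem tendsto_index (F : FiltrationSeries Γ) [Infinite Γ] (hF : ∀ i, (F.seq i).index ≠ 0) :
    Tendsto (fun i => (F.seq i).index) atTop atTop := by
  refine tendsto_atTop_atTop_of_monotone (F.index_mono hF) fun b => ?_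
  by_contra! hb
  obtain ⟨i, hi⟩ : ∃ i, ∀ j, (F.seq j).index ≤ (F.seq i).index := by
    have hfin : (Set.range fun i => (F.seq i).index).Finite :=
      (Set.finite_lt_nat b).subset (by rintro _ ⟨i, rfl⟩; exact hb i)
    obtain ⟨_, ⟨i, rfl⟩, hi⟩ := Set.exists_max_image _ id hfin (Set.range_nonempty _)
    exact ⟨i, fun j => hi _ ⟨j, rfl⟩⟩
  have h1 : ∀ j, F.seq i ≤ F.seq j := by
    intro j
    rcases le_total j i with h | h
    · exact F.anti h
    · have h2 := Subgroup.relIndex_mul_index (F.anti h)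
      have h3 := F.index_mono hF h
      have h4 : (F.seq j).index = (F.seq i).index := le_antisymm (hi j) h3
      rw [h4] at h2
      rw [← Subgroup.relIndex_eq_one]
      exact Nat.eq_of_mul_eq_mul_right (Nat.pos_of_ne_zero (hF i)) (by rw [h2, one_mul])
  have h2 : F.seq i = ⊥ := by
    rw [eq_bot_iff, ← F.iInf_eq]
    exact le_iInf h1
  have := hF i
  rw [h2, Subgroup.index_bot] at this
  exact this Nat.card_eq_zero_of_infinite

/-- The cosets of H ∩ Γ_i in H form a cover by |H : H ∩ Γ_i| sets of diameter at most |Γ : Γ_i|⁻¹.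
-/
theorem hdim_le (F : FiltrationSeries Γ) [Infinite Γ] (hF : ∀ i, (F.seq i).index ≠ 0)
    (H : Subgroup Γ) {s : NNReal}
    (h : ∀ᶠ i in atTop, ((F.seq i).relIndex H : ℝ≥0∞) ≤ ((F.seq i).index : ℝ≥0∞) ^ (s : ℝ)) :
    F.hdim (H : Set Γ) ≤ s := by
  have hfin : ∀ i, Finite (H ⧸ (F.seq i).subgroupOf H) := by
    intro i
    have : ((F.seq i).subgroupOf H).index ≠ 0 := fun h0 =>
      hF i (Subgroup.index_eq_zero_of_relIndex_eq_zero h0)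
    exact Nat.finite_of_card_ne_zero this
  let : ∀ i, Fintype (H ⧸ (F.seq i).subgroupOf H) := fun i => Fintype.ofFinite _
  refine @dimH_le_of_cover Γ F.emetric (H : Set Γ) s (fun i => ((F.seq i).index : ℝ≥0∞)⁻¹) ?_
    (fun i => H ⧸ (F.seq i).subgroupOf H) _
    (fun i q => {x | ∃ y : H, (y : Γ) = x ∧ (QuotientGroup.mk y : H ⧸ _) = q}) ?_ ?_ ?_
  · rw [← ENNReal.inv_top]
    exact tendsto_inv_iff.2 (ENNReal.tendsto_nat_nhds_top.comp (F.tendsto_index hF))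
  · intro i q
    refine @ediam_le Γ _ F.emetric.toPseudoEMetricSpace _ ?_
    rintro _ ⟨x, rfl, hx⟩ _ ⟨y, rfl, hy⟩
    refine F.filtDist_le_of_mem ?_
    -- The cosets are left cosets but the metric uses x y⁻¹; normality of Γ_i reconciles the two.
    rw [← hy, QuotientGroup.eq] at hx
    have h1 : (x : Γ)⁻¹ * y ∈ F.seq i := hx
    rw [← inv_mem_iff, mul_inv_rev, inv_inv]
    exact (F.normal i).mem_comm h1
  · intro i x hx
    rw [Set.mem_iUnion]
    exact ⟨QuotientGroup.mk ⟨x, hx⟩, ⟨x, hx⟩, rfl, rfl⟩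
  · refine h.mono fun i hi => ?_
    rw [← Nat.card_eq_fintype_card]
    change ((F.seq i).relIndex H : ℝ≥0∞) * _ ≤ 1
    rw [ENNReal.inv_rpow]
    exact (mul_le_mul_left hi _).trans (ENNReal.mul_inv_le_one _)

/-- A mass distribution argument: enlarge each set of a fine cover to a coset of some Γ_i, extract a
finite subcover by compactness, and use that the reciprocal indices in a finite cover of a group by
cosets sum to at least 1. -/
theorem le_hdim (F : FiltrationSeries Γ) [Infinite Γ] [IsTopologicalGroup Γ] [CompactSpace Γ]
    (hF : ∀ i, (F.seq i).index ≠ 0)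
    (H : Subgroup Γ) (hH : IsClosed (H : Set Γ)) {s : NNReal} (hs : 0 < s)
    (h : ∀ᶠ i in atTop, ((F.seq i).index : ℝ≥0∞) ^ (s : ℝ) ≤ ((F.seq i).relIndex H : ℝ≥0∞)) :
    s ≤ F.hdim (H : Set Γ) := by
  obtain ⟨i₀, hi₀⟩ := eventually_atTop.1 h
  have hpos : ∀ i, (0 : ℝ≥0∞) < ((F.seq i).index : ℝ≥0∞)⁻¹ := fun i =>
    ENNReal.inv_pos.2 (ENNReal.natCast_ne_top _)
  have hlim : Tendsto (fun i => (((F.seq i).index : ℝ≥0∞) ^ (s : ℝ))⁻¹) atTop (𝓝 0) := by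
    have h1 : Tendsto (fun i => ((F.seq i).index : ℝ≥0∞)⁻¹) atTop (𝓝 0) := by
      rw [← ENNReal.inv_top]
      exact tendsto_inv_iff.2 (ENNReal.tendsto_nat_nhds_top.comp (F.tendsto_index hF))
    have h2 := h1.ennrpow_const (s : ℝ)
    rw [ENNReal.zero_rpow_of_pos (by exact_mod_cast hs)] at h2
    simpa [ENNReal.inv_rpow] using h2
  -- a small set lies in a coset whose relative size is controlled by the diameter
  have key : ∀ (U : Set Γ), U.Nonempty →
      @ediam Γ F.emetric.toPseudoEMetricSpace U ≤ ((F.seq i₀).index : ℝ≥0∞)⁻¹ / 2 →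
      ∀ ε : ℝ≥0∞, 0 < ε → ∃ i, ∃ x, (∀ y ∈ U, y * x⁻¹ ∈ F.seq i) ∧
        ((F.seq i).relIndex H : ℝ≥0∞)⁻¹ ≤
          @ediam Γ F.emetric.toPseudoEMetricSpace U ^ (s : ℝ) + ε := by
    rintro U ⟨x, hx⟩ hU ε hε
    -- A set contained in one coset of every Γ_i may have diameter 0; the slack ε pays for a coset
    -- deep enough in the chain.
    by_cases hall : ∀ i, ∀ y ∈ U, y * x⁻¹ ∈ F.seq i
    · obtain ⟨i, hi1, hi2⟩ := ((hlim.eventually_le_const hε).and (eventually_ge_atTop i₀)).exists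
      refine ⟨i, x, hall i, ?_⟩
      exact (ENNReal.inv_le_inv.2 (hi₀ i hi2)).trans (hi1.trans le_add_self)
    · classical
      push Not at hall
      -- Take i just before the first term separating points of U: U lies in one coset of Γ_i, and
      -- its diameter is at least |Γ : Γ_i|⁻¹.
      have hne : Nat.find hall ≠ 0 := by
        intro h0
        obtain ⟨y, -, hy⟩ := Nat.find_spec hall
        rw [h0, F.zero_eq] at hy
        exact hy trivial
      obtain ⟨i, hi⟩ := Nat.exists_eq_succ_of_ne_zero hne
      obtain ⟨y, hyU, hy⟩ := Nat.find_spec hall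
      rw [hi] at hy
      have hdiam : ((F.seq i).index : ℝ≥0∞)⁻¹ ≤ @ediam Γ F.emetric.toPseudoEMetricSpace U :=
        (F.le_filtDist_of_notMem hF hy).trans
          (@edist_le_ediam_of_mem Γ _ _ _ F.emetric.toPseudoEMetricSpace hyU hx)
      have hi1 : i₀ ≤ i := by
        by_contra hlt
        have h1 : ((F.seq i₀).index : ℝ≥0∞)⁻¹ ≤ ((F.seq i).index : ℝ≥0∞)⁻¹ :=
          ENNReal.inv_le_inv.2 (Nat.cast_le.2 (F.index_mono hF (by omega)))
        refine absurd (h1.trans (hdiam.trans hU)) (not_le.2 (ENNReal.half_lt_self (hpos i₀).ne' ?_))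
        exact ENNReal.inv_ne_top.2 (Nat.cast_ne_zero.2 (hF i₀))
      refine ⟨i, x, fun z hz => ?_, ?_⟩
      · by_contra hz'
        exact Nat.find_min hall (m := i) (by omega) ⟨z, hz, hz'⟩
      · refine (ENNReal.inv_le_inv.2 (hi₀ i hi1)).trans (le_trans ?_ le_self_add)
        rw [← ENNReal.inv_rpow]
        exact ENNReal.rpow_le_rpow hdiam s.2
  -- Halving the admissible diameter gives the strict inequality that forces i ≥ i₀ in `key`. The
  -- slacks ε n total at most 1/2, so 1/2 of the total mass 1 remains.
  refine @le_dimH_of_forall_cover Γ F.emetric (H : Set Γ) s 2⁻¹ (((F.seq i₀).index : ℝ≥0∞)⁻¹ / 2)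
    (by simp) (ENNReal.half_pos (hpos i₀).ne') ?_
  intro t hcov hdiam
  obtain ⟨ε, hε, hεsum⟩ := ENNReal.exists_pos_sum_of_countable' (ι := ℕ) (ε := 2⁻¹) (by simp) 
  have hch : ∀ n, ∃ i, ∃ x, (t n).Nonempty → (∀ y ∈ t n, y * x⁻¹ ∈ F.seq i) ∧
        ((F.seq i).relIndex H : ℝ≥0∞)⁻¹ ≤
          @ediam Γ F.emetric.toPseudoEMetricSpace (t n) ^ (s : ℝ) + ε n := by
    intro n
    by_cases hn : (t n).Nonempty
    · obtain ⟨i, x, h⟩ := key (t n) hn (hdiam n) (ε n) (hε n)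
      exact ⟨i, x, fun _ => h⟩
    · exact ⟨0, 1, fun h => absurd h hn⟩
  choose i x hix using hch
  -- the open cosets cover the compact group `H`
  have hcomp : IsCompact (H : Set Γ) := hH.isCompact
  obtain ⟨T, hT⟩ := hcomp.elim_finite_subcover
    (fun n => {y | (t n).Nonempty ∧ y * (x n)⁻¹ ∈ F.seq (i n)}) (fun n => by
      by_cases hn : (t n).Nonempty
      · simp only [hn, true_and]
        exact (F.isOpen (i n)).preimage (continuous_mul_const (x n)⁻¹)
      · simp [hn]) (fun y hy => by
      obtain ⟨n, hn⟩ := Set.mem_iUnion.1 (hcov hy)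
      exact Set.mem_iUnion.2 ⟨n, ⟨y, hn⟩, (hix n ⟨y, hn⟩).1 y hn⟩)
  classical
  -- Only cosets that meet H are kept, so that each has a representative z n in H and restricts to a
  -- coset of H ∩ Γ_i in H.
  let T' := T.filter fun n => (t n).Nonempty ∧ ∃ y : H, (y : Γ) * (x n)⁻¹ ∈ F.seq (i n)
  have hz : ∀ n, ∃ z : H, n ∈ T' → (z : Γ) * (x n)⁻¹ ∈ F.seq (i n) := by
    intro n
    by_cases hn : n ∈ T'
    · obtain ⟨-, -, y, hy⟩ := Finset.mem_filter.1 hn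
      exact ⟨y, fun _ => hy⟩
    · exact ⟨1, fun h => absurd h hn⟩
  choose z hz using hz
  have hcover : ⋃ n ∈ T', z n • ((((F.seq (i n)).subgroupOf H : Subgroup H)) : Set H) =
      Set.univ := by
    refine Set.eq_univ_of_forall fun y => ?_
    obtain ⟨n, hn, hy1, hy2⟩ := Set.mem_iUnion₂.1 (hT y.2)
    have hnT : n ∈ T' := Finset.mem_filter.2 ⟨hn, hy1, y, hy2⟩
    refine Set.mem_iUnion₂.2 ⟨n, hnT, ?_⟩
    rw [mem_leftCoset_iff]
    change ((z n : Γ))⁻¹ * (y : Γ) ∈ F.seq (i n)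
    refine (F.normal (i n)).mem_comm ?_
    have := mul_mem hy2 (inv_mem (hz n hnT))
    simpa [mul_assoc] using this
  have hsum := Subgroup.one_le_sum_inv_index_of_leftCoset_cover hcover
  have hrel : ∀ j, (F.seq j).relIndex H ≠ 0 := fun j h0 =>
    hF j (Subgroup.index_eq_zero_of_relIndex_eq_zero h0)
  have hsum' : (1 : ℝ≥0∞) ≤ ∑ n ∈ T', ((F.seq (i n)).relIndex H : ℝ≥0∞)⁻¹ := by
    have h1 : (1 : ℝ) ≤ ∑ n ∈ T', ((F.seq (i n)).relIndex H : ℝ)⁻¹ := by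
      have h0 := (Rat.cast_le (K := ℝ)).2 hsum
      push_cast at h0
      exact h0
    have h2 := ENNReal.ofReal_le_ofReal h1
    rw [ENNReal.ofReal_one, ENNReal.ofReal_sum_of_nonneg (fun _ _ => by positivity)] at h2
    refine h2.trans (Finset.sum_le_sum fun n _ => ?_)
    rw [ENNReal.ofReal_inv_of_pos (Nat.cast_pos.2 (Nat.pos_of_ne_zero (hrel _))),
      ENNReal.ofReal_natCast]
  have hle : (1 : ℝ≥0∞) ≤ (∑' n, ⨆ _ : (t n).Nonempty,
      @ediam Γ F.emetric.toPseudoEMetricSpace (t n) ^ (s : ℝ)) + 2⁻¹ := by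
    calc (1 : ℝ≥0∞) ≤ ∑ n ∈ T', ((F.seq (i n)).relIndex H : ℝ≥0∞)⁻¹ := hsum'
      _ ≤ ∑ n ∈ T', ((⨆ _ : (t n).Nonempty,
          @ediam Γ F.emetric.toPseudoEMetricSpace (t n) ^ (s : ℝ)) + ε n) := by
        refine Finset.sum_le_sum fun n hn => ?_
        have hne := (Finset.mem_filter.1 hn).2.1
        rw [iSup_pos hne]
        exact (hix n hne).2
      _ ≤ ∑' n, ((⨆ _ : (t n).Nonempty,
          @ediam Γ F.emetric.toPseudoEMetricSpace (t n) ^ (s : ℝ)) + ε n) := ENNReal.sum_le_tsum _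
      _ = (∑' n, ⨆ _ : (t n).Nonempty,
          @ediam Γ F.emetric.toPseudoEMetricSpace (t n) ^ (s : ℝ)) + ∑' n, ε n :=
        ENNReal.tsum_add
      _ ≤ _ := add_le_add_right hεsum.le _
  have h12 : (1 : ℝ≥0∞) = 2⁻¹ + 2⁻¹ := ENNReal.inv_two_add_inv_two.symm
  rw [h12] at hle
  exact (ENNReal.add_le_add_iff_right (by simp)).1 hle

end FiltrationSeries

end HausdorffDimension

namespace TreeAut

variable {m : ℕ}

/-! ### Regular branch groups and their closures -/

theorem graft_insert {A : Finset (Vertex m)} {w : Vertex m} (hw : w ∉ A)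
    (hA' : PrefixFree ((insert w A : Finset (Vertex m)) : Set (Vertex m)))
    (hA : PrefixFree (A : Set (Vertex m))) (s : Vertex m → TreeAut m) :
    graft hA' s = place w (s w) * graft hA s := by
  refine ext_apply fun u => ?_
  rw [mul_apply]
  have hwm : w ∈ ((insert w A : Finset (Vertex m)) : Set (Vertex m)) := by simp
  have hAm : ∀ v ∈ A, v ∈ ((insert w A : Finset (Vertex m)) : Set (Vertex m)) := by
    intro v hv
    simp [hv]
  have hne : ∀ z, ∀ v ∈ A, v <+: z → ¬ w <+: z := by
    intro z v hv h1 h2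
    have := hA'.eq_of_prefix hwm (hAm v hv) h2 h1
    exact hw (this ▸ hv)
  by_cases h : ∃ v ∈ (A : Set (Vertex m)), v <+: u
  · obtain ⟨v, hv, z, rfl⟩ := h
    rw [graft_apply_append hA s hv, graft_apply_append hA' s (hAm v hv), place_apply_of_not]
    exact hne _ v hv (List.prefix_append _ _)
  · rw [graft_apply_of_not hA s h]
    by_cases h' : w <+: u
    · obtain ⟨z, rfl⟩ := h'
      rw [place_apply_append, graft_apply_append hA' s hwm]
    · rw [place_apply_of_not _ h', graft_apply_of_not hA' s]
      rintro ⟨v, hv, hvu⟩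
      rcases Finset.mem_insert.1 hv with rfl | hv
      · exact h' hvu
      · exact h ⟨v, hv, hvu⟩

theorem graft_finset_mem {L : Subgroup (TreeAut m)} {s : Vertex m → TreeAut m}
    (A : Finset (Vertex m)) (hA : PrefixFree (A : Set (Vertex m)))
    (h : ∀ w ∈ A, place w (s w) ∈ L) : graft hA s ∈ L := by
  induction A using Finset.induction_on with
  | empty =>
    have : graft hA s = 1 := ext_apply fun u => graft_apply_of_not hA s (by simp)
    rw [this]
    exact one_mem L
  | insert w A hw ih =>
    have hA2 : PrefixFree (A : Set (Vertex m)) := hA.mono (by simp)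
    rw [graft_insert hw hA hA2]
    exact mul_mem (h w (by simp)) (ih hA2 fun v hv => h v (by simp [hv]))

/-- A self-similar level-transitive group `G` together with a normal branching subgroup `K` of
finite index. -/
structure IsNormalBranch (G K : Subgroup (TreeAut m)) : Prop where
  sec_mem : ∀ g ∈ G, ∀ v, sec g v ∈ G
  transitive : IsLevelTransitive G
  le : K ≤ G
  relIndex_ne_zero : K.relIndex G ≠ 0
  conj_mem : ∀ g ∈ G, ∀ k ∈ K, g * k * g⁻¹ ∈ K
  place_mem : ∀ w, ∀ k ∈ K, place w k ∈ K

theorem IsBranching.place_singleton_mem {K : Subgroup (TreeAut m)} (hK : IsBranching K) (x : Fin m)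
    {k : TreeAut m} (hk : k ∈ K) : place [x] k ∈ K := by
  classical
  obtain ⟨g, ⟨hgK, hg1⟩, hg⟩ := hK (fun y => if y = x then k else 1) (fun y => by
    split_ifs
    exacts [hk, one_mem K])
  have : place [x] k = g := by
    refine ext_apply fun u => ?_
    rcases u with _ | ⟨y, u⟩
    · rw [g.2.1, (place [x] k).2.1]
    · have h1 := hg y u
      rw [hg1 [y] rfl] at h1
      by_cases hyx : y = x
      · subst hyx
        simp only [if_true] at h1
        exact (place_apply_append [y] k u).trans h1.symm
      · rw [if_neg hyx] at h1
        rw [place_apply_of_not _ (by simpa using fun h => hyx h.symm)]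
        exact h1.symm
  rw [this]
  exact hgK

/-- The normal core still branches: conjugating a copy at a letter by g gives a copy, at another
letter, of a conjugate by a section of g, and that conjugate lies in the core, hence in K. -/
theorem IsRegularBranch.exists_isNormalBranch {G : Subgroup (TreeAut m)} (hG : IsRegularBranch G) :
    ∃ K, IsNormalBranch G K := by
  obtain ⟨hsec, htrans, K, hKG, hfin, hK⟩ := hG
  have hsec' : ∀ g ∈ G, ∀ v, sec g v ∈ G := by
    intro g hg v
    obtain ⟨h, h1, h2⟩ := hsec g hg v
    rwa [← h2.eq_sec]
  have hmem : ∀ k, k ∈ (K.subgroupOf G).normalCore.map G.subtype ↔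
      k ∈ G ∧ ∀ g ∈ G, g * k * g⁻¹ ∈ K := by
    intro k
    constructor
    · rintro ⟨k, hk, rfl⟩
      exact ⟨k.2, fun g hg => hk ⟨g, hg⟩⟩
    · rintro ⟨h1, h2⟩
      exact ⟨⟨k, h1⟩, fun g => h2 g.1 g.2, rfl⟩
  have hconj : ∀ g ∈ G, ∀ k ∈ (K.subgroupOf G).normalCore.map G.subtype,
      g * k * g⁻¹ ∈ (K.subgroupOf G).normalCore.map G.subtype := by
    intro g hg k hk
    rw [hmem] at hk ⊢
    refine ⟨mul_mem (mul_mem hg hk.1) (inv_mem hg), fun h hh => ?_⟩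
    have := hk.2 (h * g) (mul_mem hh hg)
    simpa [mul_assoc] using this
  refine ⟨(K.subgroupOf G).normalCore.map G.subtype, hsec', htrans, ?_, ?_, hconj, ?_⟩
  · exact fun k hk => ((hmem k).1 hk).1
  · have h1 : ((K.subgroupOf G).normalCore.map G.subtype).subgroupOf G =
        (K.subgroupOf G).normalCore := by
      rw [Subgroup.subgroupOf, Subgroup.comap_map_eq_self_of_injective G.subtype_injective]
    rw [Subgroup.relIndex, h1]
    exact Subgroup.FiniteIndex.index_ne_zero
  · have hx : ∀ x, ∀ k ∈ (K.subgroupOf G).normalCore.map G.subtype,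
        place [x] k ∈ (K.subgroupOf G).normalCore.map G.subtype := by
      intro x k hk
      have hplace : ∀ g ∈ G, g * place [x] k * g⁻¹ ∈ K := by
        intro g hg
        rw [conj_place]
        obtain ⟨y, hy⟩ := List.length_eq_one_iff.1 ((length_apply g [x]).trans rfl)
        rw [hy]
        refine hK.place_singleton_mem y ?_
        have := ((hmem _).1 (hconj _ (hsec' g hg [x]) k hk)).2 1 (one_mem G)
        simpa using this
      rw [hmem]
      refine ⟨?_, hplace⟩
      have := hKG (hplace 1 (one_mem G))
      simpa using this
    intro w
    induction w with
    | nil =>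
      intro k hk
      have : place [] k = k := ext_apply fun u => place_apply_append [] k u
      rwa [this]
    | cons x w ih =>
      intro k hk
      rw [← List.singleton_append, place_append]
      exact hx x _ (ih k hk)

theorem sec_mem_topologicalClosure {G : Subgroup (TreeAut m)} (hG : ∀ g ∈ G, ∀ v, sec g v ∈ G)
    {g : TreeAut m} (hg : g ∈ G.topologicalClosure) (v : Vertex m) :
    sec g v ∈ G.topologicalClosure := by
  rw [mem_topologicalClosure_iff]
  intro n
  obtain ⟨h, h1, h2⟩ := mem_topologicalClosure_iff.1 hg (v.length + n)
  refine ⟨sec h v, hG h h1 v, fun u hu => ?_⟩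
  have h3 := h2 (v ++ u) (by rw [List.length_append, hu])
  rw [apply_append, apply_append, apply_eq_of_le h2 (Nat.le_add_right _ _)] at h3
  exact List.append_cancel_left h3

namespace IsNormalBranch

variable {G K : Subgroup (TreeAut m)}

theorem closure_le (hK : IsNormalBranch G K) : K.topologicalClosure ≤ G.topologicalClosure :=
  Subgroup.topologicalClosure_mono hK.le

theorem place_mem_closure (hK : IsNormalBranch G K) (w : Vertex m) {k : TreeAut m}
    (hk : k ∈ K.topologicalClosure) : place w k ∈ K.topologicalClosure :=
  map_mem_closure (continuous_place w) hk fun k hk => hK.place_mem w k hk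

/-- V may be infinite, but only its finitely many vertices of length at most n affect level n, and a
finite graft is a product of placed elements of K. -/
theorem graft_mem_closure (hK : IsNormalBranch G K) {V : Set (Vertex m)} (hV : PrefixFree V)
    {s : Vertex m → TreeAut m} (hs : ∀ v ∈ V, s v ∈ K) : graft hV s ∈ K.topologicalClosure := by
  classical
  rw [mem_topologicalClosure_iff]
  intro n
  have hfin : (V ∩ {v | v.length ≤ n}).Finite :=
    (List.finite_length_le (Fin m) n).subset Set.inter_subset_right
  have hA : PrefixFree (hfin.toFinset : Set (Vertex m)) := by
    rw [Set.Finite.coe_toFinset]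
    exact hV.mono Set.inter_subset_left
  refine ⟨graft hA s, graft_finset_mem _ hA fun w hw => hK.place_mem w _ (hs w ?_),
    fun u hu => ?_⟩
  · exact ((Set.Finite.mem_toFinset _).1 hw).1
  · by_cases h : ∃ v ∈ V, v <+: u
    · obtain ⟨v, hv, z, rfl⟩ := h
      rw [graft_apply_append hV s hv, graft_apply_append hA s]
      rw [List.length_append] at hu
      simpa [hv] using by omega
    · rw [graft_apply_of_not hV s h, graft_apply_of_not hA s]
      rintro ⟨v, hv, hvu⟩
      exact h ⟨v, ((Set.Finite.mem_toFinset _).1 hv).1, hvu⟩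

/-- The closure of K is closed of finite index in the closure of G, hence open. -/
theorem exists_levelStab_le (hK : IsNormalBranch G K) :
    ∃ N, ∀ g ∈ G.topologicalClosure, g ∈ levelStab m N → g ∈ K.topologicalClosure := by
  have hfin : (K.topologicalClosure.subgroupOf G.topologicalClosure).FiniteIndex :=
    ⟨Subgroup.relIndex_topologicalClosure_ne_zero hK.relIndex_ne_zero⟩
  have hopen := Subgroup.isOpen_of_isClosed_of_finiteIndex
    (K.topologicalClosure.subgroupOf G.topologicalClosure)
    (K.isClosed_topologicalClosure.preimage continuous_subtype_val)
  obtain ⟨U, hU, hU'⟩ := isOpen_induced_iff.1 hopen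
  have h1 : (1 : G.topologicalClosure) ∈ Subtype.val ⁻¹' U := by
    rw [hU']
    exact one_mem _
  obtain ⟨N, hN⟩ := hU 1 h1
  refine ⟨N, fun g hg hgN => ?_⟩
  have h2 : (⟨g, hg⟩ : G.topologicalClosure) ∈ Subtype.val ⁻¹' U := hN g (by simpa using hgN)
  rw [hU'] at h2
  exact h2

/-- An element of a deep enough level stabilizer has its sections at level k in the closure of K.
Branching puts the copies of these sections into the closure of G, and the element is their product
over A. -/
theorem exists_mem_iSup_rist (hK : IsNormalBranch G K) (k : ℕ) :
    ∃ N, ∀ g : G.topologicalClosure, g.1 ∈ levelStab m N → ∀ A : Finset (Vertex m),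
      (∀ w ∈ A, w.length = k) →
      (∀ w : Vertex m, w.length = k → w ∉ A → ∀ u, g.1.1 (w ++ u) = w ++ u) →
      g ∈ ⨆ w ∈ A, rist G.topologicalClosure w := by
  obtain ⟨N, hN⟩ := hK.exists_levelStab_le
  refine ⟨k + N, fun g hg A hA hfix => ?_⟩
  have hAp : PrefixFree (A : Set (Vertex m)) := prefixFree_of_length hA
  have hgk : ∀ u : Vertex m, u.length ≤ k → g.1.1 u = u := fun u hu =>
    levelStab_antitone (hu.trans (Nat.le_add_right k N)) hg u rfl
  have hgraft : g.1 = graft hAp (sec g.1) := by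
    refine ext_apply fun u => ?_
    by_cases h : ∃ v ∈ (A : Set (Vertex m)), v <+: u
    · obtain ⟨v, hv, z, rfl⟩ := h
      rw [graft_apply_append hAp _ hv, apply_append, hgk v (hA v hv).le]
    · rw [graft_apply_of_not hAp _ h]
      rcases le_total u.length k with hu | hu
      · exact hgk u hu
      · have h1 := hfix (u.take k) (by simp [hu])
          (fun hmem => h ⟨_, hmem, List.take_prefix k u⟩) (u.drop k)
        rwa [List.take_append_drop] at h1
  have hmem : g.1 ∈ (⨆ w ∈ A, rist G.topologicalClosure w).map G.topologicalClosure.subtype := by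
    rw [hgraft]
    refine graft_finset_mem A hAp fun w hw => ?_
    have h1 : place w (sec g.1 w) ∈ G.topologicalClosure :=
      hK.closure_le (hK.place_mem_closure w (hN _ (sec_mem_topologicalClosure hK.sec_mem g.2 w)
        (sec_mem_levelStab hg (hA w hw))))
    refine ⟨⟨_, h1⟩, ?_, rfl⟩
    exact (le_iSup₂_of_le w hw le_rfl : rist G.topologicalClosure w ≤ _) (supportedAt_place w _)
  obtain ⟨g', hg', h⟩ := hmem
  rwa [← Subtype.ext (show g'.1 = g.1 from h)]

end IsNormalBranch

end TreeAut

/-! ### Relative indices and commuting families of subgroups -/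

namespace Subgroup

theorem relIndex_eq_card_map {A : Type*} [Group A] (N : Subgroup A) [N.Normal] (H : Subgroup A) :
    N.relIndex H = Nat.card (H.map (QuotientGroup.mk' N)) := by
  rw [← relIndex_ker, QuotientGroup.ker_mk']

theorem relIndex_ne_zero_of_index {A : Type*} [Group A] {N : Subgroup A} (hN : N.index ≠ 0)
    (H : Subgroup A) : N.relIndex H ≠ 0 := fun h => hN (index_eq_zero_of_relIndex_eq_zero h)

theorem relIndex_le_relIndex_of_le {A : Type*} [Group A] {N : Subgroup A} (hN : N.index ≠ 0)
    {H H' : Subgroup A} (h : H ≤ H') : N.relIndex H ≤ N.relIndex H' :=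
  relIndex_le_of_le_right h (relIndex_ne_zero_of_index hN H')

theorem relIndex_le_index {A : Type*} [Group A] {N : Subgroup A} (hN : N.index ≠ 0)
    (H : Subgroup A) : N.relIndex H ≤ N.index := by
  rw [← relIndex_top_right]
  exact relIndex_le_relIndex_of_le hN le_top

theorem relIndex_le_mul_inf {A : Type*} [Group A] {N U H : Subgroup A} (hN : N.index ≠ 0)
    (hU : U.relIndex H ≠ 0) : N.relIndex H ≤ U.relIndex H * N.relIndex (U ⊓ H) := by
  rw [mul_comm, relIndex_inf_mul_relIndex]
  exact relIndex_le_of_le_left inf_le_left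
    (relIndex_inf_ne_zero (relIndex_ne_zero_of_index hN H) hU)

section Commuting

variable {Q ι : Type*} [Group Q] {P : ι → Subgroup Q}

theorem card_iSup_le_prod [Finite Q] [Fintype ι]
    (hcomm : Pairwise fun i j => ∀ x y : Q, x ∈ P i → y ∈ P j → Commute x y) :
    Nat.card (⨆ i, P i : Subgroup Q) ≤ ∏ i, Nat.card (P i) := by
  rw [← noncommPiCoprod_range (hcomm := hcomm), ← Nat.card_pi]
  exact Nat.card_le_card_of_surjective _ (MonoidHom.rangeRestrict_surjective _)

theorem card_iSup_eq_prod [Fintype ι]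
    (hcomm : Pairwise fun i j => ∀ x y : Q, x ∈ P i → y ∈ P j → Commute x y)
    (hind : iSupIndep P) : Nat.card (⨆ i, P i : Subgroup Q) = ∏ i, Nat.card (P i) := by
  rw [← noncommPiCoprod_range (hcomm := hcomm), ← Nat.card_pi]
  exact (Nat.card_congr (MonoidHom.ofInjective
    (injective_noncommPiCoprod_of_iSupIndep (hcomm := hcomm) hind)).toEquiv).symm

/-- The multiplication map from the direct product onto the join is surjective between finite sets
of equal size, hence injective. -/
theorem iSupIndep_of_card_iSup [Finite Q] [Fintype ι]
    (hcomm : Pairwise fun i j => ∀ x y : Q, x ∈ P i → y ∈ P j → Commute x y)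
    (hcard : Nat.card (⨆ i, P i : Subgroup Q) = ∏ i, Nat.card (P i)) : iSupIndep P := by
  classical
  have hinj : Function.Injective (noncommPiCoprod hcomm) := by
    rw [← MonoidHom.rangeRestrict_injective_iff]
    refine ((Nat.bijective_iff_surjective_and_card _).2
      ⟨MonoidHom.rangeRestrict_surjective _, ?_⟩).1
    rw [Nat.card_pi, noncommPiCoprod_range, hcard]
  intro i
  rw [disjoint_iff_inf_le]
  rintro x ⟨hx1, hx2⟩
  -- The join of the other factors consists of images of tuples with trivial i-th coordinate.
  have hle : (⨆ (j) (_ : j ≠ i), P j) ≤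
      (Pi.evalMonoidHom (fun j => P j) i).ker.map (noncommPiCoprod hcomm) := by
    refine iSup₂_le fun j hj y hy => ⟨Pi.mulSingle j ⟨y, hy⟩, ?_, ?_⟩
    · exact Pi.mulSingle_eq_of_ne hj.symm _
    · exact noncommPiCoprod_mulSingle j _
  obtain ⟨f, hf, hfx⟩ := hle hx2
  have h1 : f = Pi.mulSingle i (⟨x, hx1⟩ : P i) := by
    apply hinj
    rw [hfx, noncommPiCoprod_mulSingle]
  have h2 : f i = 1 := hf
  rw [h1, Pi.mulSingle_eq_same] at h2
  exact congrArg Subtype.val h2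

variable {A : Type*} [Group A] {N : Subgroup A} [N.Normal] {R : ι → Subgroup A}

theorem commute_map_mk (hcomm : Pairwise fun i j => ∀ x y : A, x ∈ R i → y ∈ R j → Commute x y) :
    Pairwise fun i j => ∀ x y : A ⧸ N, x ∈ (R i).map (QuotientGroup.mk' N) →
      y ∈ (R j).map (QuotientGroup.mk' N) → Commute x y := by
  rintro i j hij _ _ ⟨x, hx, rfl⟩ ⟨y, hy, rfl⟩
  exact (hcomm hij x y hx hy).map _

theorem relIndex_iSup_le_prod [Fintype ι] (hN : N.index ≠ 0)
    (hcomm : Pairwise fun i j => ∀ x y : A, x ∈ R i → y ∈ R j → Commute x y) :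
    N.relIndex (⨆ i, R i) ≤ ∏ i, N.relIndex (R i) := by
  have : Finite (A ⧸ N) := Nat.finite_of_card_ne_zero hN
  simp only [relIndex_eq_card_map, map_iSup]
  exact card_iSup_le_prod (commute_map_mk hcomm)

theorem relIndex_iSup_eq_prod [Fintype ι] (hN : N.index ≠ 0)
    (hcomm : Pairwise fun i j => ∀ x y : A, x ∈ R i → y ∈ R j → Commute x y)
    (hind : iSupIndep fun i => (R i).map (QuotientGroup.mk' N)) :
    N.relIndex (⨆ i, R i) = ∏ i, N.relIndex (R i) := by
  have : Finite (A ⧸ N) := Nat.finite_of_card_ne_zero hN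
  simp only [relIndex_eq_card_map, map_iSup]
  exact card_iSup_eq_prod (commute_map_mk hcomm) hind

end Commuting

open scoped commutatorElement in
/-- If `A` is finitely generated and `A ⧸ N` has exponent dividing `e`, then the commutator subgroup
of `A` covers `A ⧸ N` up to index `e ^ rank A`. -/
theorem index_le_relIndex_commutator_mul {A : Type*} [Group A] [Group.FG A] (N : Subgroup A)
    [N.Normal] {e : ℕ} (he : 0 < e) (h : ∀ a : A, a ^ e ∈ N) :
    N.index ≤ N.relIndex (_root_.commutator A) * e ^ Group.rank A := by
  -- A ⧸ M is abelian, of exponent dividing e and generated by rank A elements, so its order is at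
  -- most e ^ rank A.
  let M : Subgroup A := _root_.commutator A ⊔ N
  have h1 : N.relIndex M * M.index = N.index := relIndex_mul_index le_sup_right
  rw [← h1, relIndex_sup_right]
  refine Nat.mul_le_mul_left _ ?_
  let _ : CommGroup (A ⧸ M) :=
    { (inferInstance : Group (A ⧸ M)) with
      mul_comm := by
        intro x y
        obtain ⟨x, rfl⟩ := QuotientGroup.mk_surjective x
        obtain ⟨y, rfl⟩ := QuotientGroup.mk_surjective y
        refine QuotientGroup.eq.2 ((le_sup_left : _root_.commutator A ≤ M) ?_)
        have : (x * y)⁻¹ * (y * x) = ⁅y⁻¹, x⁻¹⁆ := by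
          rw [commutatorElement_def]
          group
        rw [this]
        exact commutator_mem_commutator (mem_top _) (mem_top _) }
  have h2 : Nat.card (A ⧸ M) ∣ e ^ Group.rank (A ⧸ M) :=
    card_dvd_exponent_pow_rank' (A ⧸ M) (by
      intro x
      obtain ⟨x, rfl⟩ := QuotientGroup.mk_surjective x
      exact (QuotientGroup.eq_one_iff (N := M) _).2 ((le_sup_right : N ≤ M) (h x)))
  have h3 : Group.rank (A ⧸ M) ≤ Group.rank A :=
    Group.rank_le_of_surjective (QuotientGroup.mk' M) (QuotientGroup.mk'_surjective M)
  exact (Nat.le_of_dvd (pow_pos he _) h2).trans (Nat.pow_le_pow_right he h3)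

end Subgroup

theorem tendsto_div_of_sandwich {x y e L : ℕ → ℝ} {c : ℝ} (hL : ∀ i, 0 ≤ L i)
    (hx : Filter.Tendsto (fun i => x i / L i) Filter.atTop (𝓝 c))
    (he : Filter.Tendsto (fun i => e i / L i) Filter.atTop (𝓝 0))
    (h1 : ∀ᶠ i in Filter.atTop, x i ≤ y i + e i) (h2 : ∀ᶠ i in Filter.atTop, y i ≤ x i) :
    Filter.Tendsto (fun i => y i / L i) Filter.atTop (𝓝 c) := by
  have h3 := hx.sub he
  rw [sub_zero] at h3
  refine tendsto_of_tendsto_of_tendsto_of_le_of_le' h3 hx (h1.mono fun i hi => ?_)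
    (h2.mono fun i hi => div_le_div_of_nonneg_right hi (hL i))
  rw [← sub_div]
  exact div_le_div_of_nonneg_right (by linarith) (hL i)

namespace FiltrationSeries

variable {Γ : Type*} [Group Γ] [TopologicalSpace Γ]

theorem index_ne_zero [IsTopologicalGroup Γ] [CompactSpace Γ] (F : FiltrationSeries Γ) (i : ℕ) :
    (F.seq i).index ≠ 0 := by
  have : Finite (Γ ⧸ F.seq i) := Subgroup.quotient_finite_of_isOpen _ (F.isOpen i)
  exact Nat.card_pos.ne'

theorem tendsto_log_index [Infinite Γ] [IsTopologicalGroup Γ] [CompactSpace Γ]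
    (F : FiltrationSeries Γ) :
    Filter.Tendsto (fun i => Real.log (F.seq i).index) Filter.atTop Filter.atTop :=
  Real.tendsto_log_atTop.comp
    (tendsto_natCast_atTop_atTop.comp (F.tendsto_index F.index_ne_zero))

end FiltrationSeries

namespace TreeAut

variable {m : ℕ}

instance (Γ : Subgroup (TreeAut m)) : CompactSpace Γ.topologicalClosure :=
  isCompact_iff_compactSpace.1 Γ.isClosed_topologicalClosure.isCompact

instance fintypeLevel (k : ℕ) : Fintype {v : Vertex m // v.length = k} :=
  inferInstanceAs (Fintype (List.Vector (Fin m) k))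

theorem card_level (k : ℕ) : Fintype.card {v : Vertex m // v.length = k} = m ^ k := by
  have := card_vector (α := Fin m) k
  rw [Fintype.card_fin] at this
  exact this

/-! ### Rigid stabilizers in a filtration -/

section Rist

variable {Γ : Subgroup (TreeAut m)}

theorem rist_commute {v w : Vertex m} (hlen : v.length = w.length) (hne : v ≠ w) {x y : Γ}
    (hx : x ∈ rist Γ v) (hy : y ∈ rist Γ w) : Commute x y :=
  Subtype.ext (SupportedAt.commute (g := x.1) (h := y.1) hx hy (fun h => hne (h.eq_of_length hlen))
    fun h => hne (h.eq_of_length hlen.symm).symm)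

theorem rist_pairwise_commute (k : ℕ) :
    Pairwise fun v w : {v : Vertex m // v.length = k} =>
      ∀ x y : Γ, x ∈ rist Γ v.1 → y ∈ rist Γ w.1 → Commute x y :=
  fun v w hvw _ _ hx hy =>
    rist_commute (v.2.trans w.2.symm) (fun h => hvw (Subtype.ext h)) hx hy

open scoped Pointwise in
theorem conj_smul_rist (g : Γ) (v : Vertex m) :
    MulAut.conj g • rist Γ v = rist Γ (g.1.1 v) := by
  have key : ∀ (g : Γ) (v : Vertex m), MulAut.conj g • rist Γ v ≤ rist Γ (g.1.1 v) := by
    rintro g v _ ⟨x, hx, rfl⟩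
    have hx' : SupportedAt v x.1 := hx
    change SupportedAt (g.1.1 v) (g.1 * x.1 * g.1⁻¹)
    rw [hx'.eq_place, conj_place]
    exact supportedAt_place _ _
  refine le_antisymm (key g v) ?_
  have h1 := key g⁻¹ (g.1.1 v)
  have h2 : (g⁻¹ : Γ).1.1 (g.1.1 v) = v := inv_apply_self g.1 v
  rw [h2] at h1
  rw [← Subgroup.pointwise_smul_le_pointwise_smul_iff (a := MulAut.conj g)] at h1
  rwa [map_inv, smul_inv_smul] at h1

/-- The two rigid stabilizers are conjugate and Γ_i is normal. -/
theorem relIndex_rist_eq {F : FiltrationSeries Γ} (htrans : IsLevelTransitive Γ) {v w : Vertex m}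
    (h : v.length = w.length) (i : ℕ) :
    (F.seq i).relIndex (rist Γ v) = (F.seq i).relIndex (rist Γ w) := by
  obtain ⟨g, hg, rfl⟩ := htrans v w h
  rw [← conj_smul_rist ⟨g, hg⟩ v]
  nth_rw 2 [← Subgroup.Normal.conj_smul_eq_self (⟨g, hg⟩ : Γ) (F.seq i)]
  rw [Subgroup.relIndex_pointwise_smul]

/-- For almost all `i` the images in `Γ ⧸ Γ_i` of the rigid stabilizers of the vertices of any fixed
level generate their direct product. -/
def IsDirect (F : FiltrationSeries Γ) : Prop :=
  ∀ k : ℕ, 1 ≤ k → ∀ᶠ i in Filter.atTop, iSupIndep fun v : {v : Vertex m // v.length = k} =>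
    (rist Γ v.1).map (QuotientGroup.mk' (F.seq i))

/-- Niceness supplies only an abstract isomorphism. The orders it equates suffice, since the factors
commute and the quotient is finite. -/
theorem IsNice.isDirect {F : FiltrationSeries Γ} (hF : ∀ i, (F.seq i).index ≠ 0)
    (h : IsNice Γ F) : IsDirect F := by
  intro k hk
  filter_upwards [h k hk] with i hi
  obtain ⟨e⟩ := hi
  have : Finite (Γ ⧸ F.seq i) := Nat.finite_of_card_ne_zero (hF i)
  refine Subgroup.iSupIndep_of_card_iSup (Subgroup.commute_map_mk (rist_pairwise_commute k)) ?_
  rw [← Nat.card_pi, ← Nat.card_congr e.toEquiv, levelRist, Subgroup.map_iSup]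

/-- The automorphisms that act trivially below the vertex `w`. -/
def coneFixer (Γ : Subgroup (TreeAut m)) (w : Vertex m) : Subgroup Γ where
  carrier := {g | ∀ u, g.1.1 (w ++ u) = w ++ u}
  one_mem' := fun _ => rfl
  mul_mem' := by
    intro g h hg hh u
    change g.1.1 (h.1.1 (w ++ u)) = w ++ u
    rw [hh u, hg u]
  inv_mem' := by
    intro g hg u
    change g.1.1⁻¹ (w ++ u) = w ++ u
    rw [Equiv.Perm.inv_eq_iff_eq, hg u]

/-- If a in rist(v) agrees modulo St(n) with a product b from the other rigid stabilizers, then a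
acts on level n below v as b does, that is trivially, and it is trivial elsewhere anyway. -/
theorem isDirect_levelStabFiltration (Γ : Subgroup (TreeAut m)) :
    IsDirect (levelStabFiltration Γ) := by
  intro k _
  refine Filter.Eventually.of_forall fun n v => ?_
  rw [disjoint_iff_inf_le]
  rintro _ ⟨⟨a, ha, rfl⟩, hb⟩
  simp only [← Subgroup.map_iSup] at hb
  obtain ⟨b, hb, hab⟩ := hb
  have hb' : b ∈ coneFixer Γ v.1 := by
    refine (iSup₂_le fun w hw => ?_ : (⨆ (w : {v : Vertex m // v.length = k}) (_ : w ≠ v),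
      rist Γ w.1) ≤ coneFixer Γ v.1) hb
    intro g hg u
    refine hg.2 _ fun hpre => hw (Subtype.ext ?_)
    exact (prefixFree_of_length (V := {v : Vertex m | v.length = k}) fun _ h => h).eq_of_prefix
      w.2 v.2 hpre (List.prefix_append _ _)
  have h1 : b⁻¹ * a ∈ (levelStabFiltration Γ).seq n := QuotientGroup.eq.1 hab
  have h2 : b.1⁻¹ * a.1 ∈ levelStab m n := h1
  have h3 : a.1 ∈ levelStab m n := by
    intro u hu
    by_cases hvu : v.1 <+: u
    · rw [inv_mul_mem_levelStab_iff.1 h2 u hu]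
      obtain ⟨u, rfl⟩ := hvu
      exact hb' u
    · exact ha.2 u hvu
  exact (QuotientGroup.eq_one_iff a).2 h3

theorem IsDirect.relIndex_iSup {F : FiltrationSeries Γ} (hF : ∀ i, (F.seq i).index ≠ 0)
    (h : IsDirect F) {k : ℕ} (hk : 1 ≤ k) (B : Finset (Vertex m)) (hB : ∀ w ∈ B, w.length = k)
    {P : Vertex m → Subgroup Γ} (hP : ∀ w, P w ≤ rist Γ w) :
    ∀ᶠ i in Filter.atTop, (F.seq i).relIndex (⨆ w : B, P w.1) =
      ∏ w : B, (F.seq i).relIndex (P w.1) := by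
  filter_upwards [h k hk] with i hi
  refine Subgroup.relIndex_iSup_eq_prod (hF i) ?_ ?_
  · intro v w hvw x y hx hy
    exact rist_commute ((hB v.1 v.2).trans (hB w.1 w.2).symm) (fun h => hvw (Subtype.ext h))
      (hP _ hx) (hP _ hy)
  · have h1 := hi.comp (f := fun w : B => ⟨w.1, hB w.1 w.2⟩) fun v w hvw =>
      Subtype.ext (congrArg Subtype.val hvw :)
    exact h1.mono fun w => Subgroup.map_mono (hP w.1)

end Rist

end TreeAut

namespace TreeAut

variable {m : ℕ}

/-! ### Asymptotic size of rigid stabilizers and of placed subgroups -/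

theorem IsLevelTransitive.mono {G H : Subgroup (TreeAut m)} (hG : IsLevelTransitive G) (h : G ≤ H) :
    IsLevelTransitive H := fun u v huv =>
  let ⟨g, hg, hgu⟩ := hG u v huv
  ⟨g, h hg, hgu⟩

theorem index_levelStab_ne_zero (n : ℕ) : (levelStab m n).index ≠ 0 := by
  have : Finite (TreeAut m ⧸ levelStab m n) :=
    Subgroup.quotient_finite_of_isOpen _ (isOpen_levelStab n)
  exact Nat.card_pos.ne'

theorem pow_le_relIndex_levelStab (hm : 0 < m) {G : Subgroup (TreeAut m)}
    (hG : IsLevelTransitive G) (n : ℕ) : m ^ n ≤ (levelStab m n).relIndex G := by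
  have hne := Subgroup.relIndex_ne_zero_of_index (index_levelStab_ne_zero (m := m) n) G
  have : Finite (G ⧸ (levelStab m n).subgroupOf G) := Nat.finite_of_card_ne_zero hne
  let u₀ : Vertex m := List.replicate n ⟨0, hm⟩
  have hu₀ : u₀.length = n := List.length_replicate
  rw [← card_level (m := m) n, ← Nat.card_eq_fintype_card]
  let f : G ⧸ (levelStab m n).subgroupOf G → {v : Vertex m // v.length = n} :=
    fun q => ⟨q.out.1.1 u₀, (length_apply _ _).trans hu₀⟩
  refine Nat.card_le_card_of_surjective f fun v => ?_
  obtain ⟨g, hg, hgu⟩ := hG u₀ v.1 (hu₀.trans v.2.symm)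
  refine ⟨QuotientGroup.mk ⟨g, hg⟩, Subtype.ext ?_⟩
  have h1 := QuotientGroup.eq.1 (QuotientGroup.out_eq' (QuotientGroup.mk
    (s := (levelStab m n).subgroupOf G) (⟨g, hg⟩ : G)))
  have h2 := inv_mul_mem_levelStab_iff.1 (show _⁻¹ * g ∈ levelStab m n from h1) u₀ hu₀
  exact h2.symm.trans hgu

theorem IsLevelTransitive.infinite (hm : 2 ≤ m) {G : Subgroup (TreeAut m)}
    (hG : IsLevelTransitive G) : Infinite G := by
  by_contra hfin
  rw [not_infinite_iff_finite] at hfin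
  have h1 := pow_le_relIndex_levelStab (by omega) hG (Nat.card G)
  have h2 : (levelStab m (Nat.card G)).relIndex G ≤ Nat.card G :=
    Nat.le_of_dvd Nat.card_pos (Subgroup.relIndex_dvd_card _ _)
  exact absurd (h1.trans h2) (not_le.2 (Nat.lt_pow_self (by omega)))

/-- Below each fixed vertex of level n, g permutes m children, and the order of that permutation
divides m!. -/
theorem pow_factorial_mem_levelStab {g : TreeAut m} {n : ℕ} (hg : g ∈ levelStab m n) :
    g ^ m.factorial ∈ levelStab m (n + 1) := by
  intro v hv
  obtain ⟨u, x, rfl⟩ : ∃ u x, v = u ++ [x] :=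
    ⟨v.dropLast, v.getLast (by rintro rfl; simp at hv), (List.dropLast_append_getLast _).symm⟩
  have hu : u.length = n := by simpa using hv
  choose f hf using (length_and_parent g u).2
  rw [hg u hu] at hf
  have hinj : Function.Injective f := by
    intro a b hab
    have : g.1 (u ++ [a]) = g.1 (u ++ [b]) := by rw [hf, hf, hab]
    simpa using g.1.injective this
  let σ : Equiv.Perm (Fin m) := Equiv.ofBijective f (Finite.injective_iff_bijective.1 hinj)
  have hpow : ∀ j : ℕ, (g ^ j).1 (u ++ [x]) = u ++ [(σ ^ j) x] := by
    intro j
    induction j with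
    | zero => rfl
    | succ j ih =>
      rw [pow_succ', mul_apply, ih, hf, pow_succ']
      rfl
  have hσ : σ ^ m.factorial = 1 := by
    have := pow_card_eq_one (G := Equiv.Perm (Fin m)) (x := σ)
    rwa [Fintype.card_perm, Fintype.card_fin] at this
  rw [hpow, hσ]
  rfl

theorem pow_factorial_pow_mem_levelStab (g : TreeAut m) (n : ℕ) :
    g ^ m.factorial ^ n ∈ levelStab m n := by
  induction n with
  | zero =>
    intro u hu
    rw [List.length_eq_zero_iff.1 hu]
    exact (g ^ m.factorial ^ 0).2.1
  | succ n ih =>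
    rw [pow_succ, pow_mul]
    exact pow_factorial_mem_levelStab ih

/-- The copy at the vertex `w` of the subgroup `L`. -/
noncomputable def placed (Γ L : Subgroup (TreeAut m)) (w : Vertex m) : Subgroup Γ :=
  (L.map (place w)).subgroupOf Γ

theorem placed_le_rist (Γ L : Subgroup (TreeAut m)) (w : Vertex m) : placed Γ L w ≤ rist Γ w := by
  rintro g ⟨k, -, hk⟩
  change SupportedAt w g.1
  rw [show g.1 = place w k from hk.symm]
  exact supportedAt_place w k

namespace IsNormalBranch

variable {G K : Subgroup (TreeAut m)}

theorem transitive_closure (hK : IsNormalBranch G K) : IsLevelTransitive G.topologicalClosure :=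
  hK.transitive.mono G.le_topologicalClosure

/-- One U depending only on k serves all A and H; its index becomes the constant of
`relIndex_le_prod`, uniform in the filtration. -/
theorem exists_isOpen_inf_le (hK : IsNormalBranch G K) (k : ℕ) :
    ∃ U : Subgroup G.topologicalClosure, U.index ≠ 0 ∧ ∀ (A : Finset (Vertex m)),
      (∀ w ∈ A, w.length = k) → ∀ H : Subgroup G.topologicalClosure,
      (∀ h ∈ H, ∀ w : Vertex m, w.length = k → w ∉ A → ∀ u, h.1.1 (w ++ u) = w ++ u) →
      U ⊓ H ≤ ⨆ w : A, rist G.topologicalClosure w.1 := by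
  obtain ⟨N, hN⟩ := hK.exists_mem_iSup_rist k
  refine ⟨(levelStab m N).subgroupOf _, ?_, fun A hA H hH h hh => ?_⟩
  · exact (levelStabFiltration G.topologicalClosure).index_ne_zero N
  · rw [iSup_subtype]
    exact hN h hh.1 A hA fun w hw hwA => hH h hh.2 w hw hwA

/-- The logarithmic index of a subgroup that acts trivially below all but the vertices of `A` among
those of level `k`. -/
theorem relIndex_le_prod (hK : IsNormalBranch G K) {k : ℕ} :
    ∃ C : ℕ, C ≠ 0 ∧ ∀ (F : FiltrationSeries G.topologicalClosure) (A : Finset (Vertex m)),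
      (∀ w ∈ A, w.length = k) → ∀ H : Subgroup G.topologicalClosure,
      (∀ h ∈ H, ∀ w : Vertex m, w.length = k → w ∉ A → ∀ u, h.1.1 (w ++ u) = w ++ u) →
      ∀ i, (F.seq i).relIndex H ≤
        C * ∏ w : A, (F.seq i).relIndex (rist G.topologicalClosure w.1) := by
  obtain ⟨U, hU, h⟩ := hK.exists_isOpen_inf_le k
  refine ⟨U.index, hU, fun F A hA H hH i => ?_⟩
  have hFi := F.index_ne_zero i
  refine (Subgroup.relIndex_le_mul_inf hFi (Subgroup.relIndex_ne_zero_of_index hU H)).trans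
    (Nat.mul_le_mul (Subgroup.relIndex_le_index hU H) ?_)
  refine (Subgroup.relIndex_le_relIndex_of_le hFi (h A hA H hH)).trans ?_
  refine Subgroup.relIndex_iSup_le_prod hFi fun v w hvw x y hx hy => ?_
  exact rist_commute ((hA v.1 v.2).trans (hA w.1 w.2).symm) (fun h => hvw (Subtype.ext h)) hx hy

/-- The m ^ |w| rigid stabilizers of this level have equal relative index and generate their direct
product modulo Γ_i. -/
theorem pow_relIndex_rist_le_index (hK : IsNormalBranch G K)
    {F : FiltrationSeries G.topologicalClosure} (hF : IsDirect F) {w : Vertex m}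
    (hw : 1 ≤ w.length) :
    ∀ᶠ i in Filter.atTop, (F.seq i).relIndex (rist G.topologicalClosure w) ^ m ^ w.length ≤
      (F.seq i).index := by
  filter_upwards [hF w.length hw] with i hi
  have h1 := Subgroup.relIndex_iSup_eq_prod (F.index_ne_zero i)
    (rist_pairwise_commute w.length) hi
  rw [Finset.prod_congr rfl fun v _ => relIndex_rist_eq (F := F) hK.transitive_closure v.2 i,
    Finset.prod_const, Finset.card_univ, card_level] at h1
  rw [← h1]
  exact Subgroup.relIndex_le_index (F.index_ne_zero i) _

theorem exists_index_le_mul_pow (hK : IsNormalBranch G K) (w : Vertex m) :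
    ∃ C : ℕ, C ≠ 0 ∧ ∀ (F : FiltrationSeries G.topologicalClosure) (i : ℕ),
      (F.seq i).index ≤ C * (F.seq i).relIndex (rist G.topologicalClosure w) ^ m ^ w.length := by
  classical
  obtain ⟨C, hC, h⟩ := hK.relIndex_le_prod (k := w.length)
  refine ⟨C, hC, fun F i => ?_⟩
  let A : Finset (Vertex m) :=
    Finset.univ.map (Function.Embedding.subtype fun v : Vertex m => v.length = w.length)
  have hA : ∀ v, v ∈ A ↔ v.length = w.length := by
    intro v
    simp [A]
  -- With A the whole level there is no vertex outside A, so the full group is admissible.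
  have h1 := h F A (fun v hv => (hA v).1 hv) ⊤
    (fun _ _ v hv hvA => absurd ((hA v).2 hv) hvA) i
  rw [Subgroup.relIndex_top_right, Finset.prod_congr rfl fun v _ =>
    relIndex_rist_eq (F := F) hK.transitive_closure ((hA v.1).1 v.2) i, Finset.prod_const,
    Finset.card_univ, Fintype.card_coe, Finset.card_map, Finset.card_univ, card_level] at h1
  exact h1

/-- The two preceding bounds show that m ^ |w| times the logarithm of the relative index is
eventually at most log |Γ : Γ_i| and falls short of it by at most a constant. -/
theorem tendsto_log_relIndex_rist (hm : 2 ≤ m) (hK : IsNormalBranch G K)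
    {F : FiltrationSeries G.topologicalClosure} (hF : IsDirect F) {w : Vertex m}
    (hw : 1 ≤ w.length) :
    Filter.Tendsto (fun i => Real.log ((F.seq i).relIndex (rist G.topologicalClosure w)) /
      Real.log (F.seq i).index) Filter.atTop (𝓝 ((m : ℝ) ^ w.length)⁻¹) := by
  have : Infinite G.topologicalClosure := hK.transitive_closure.infinite hm
  obtain ⟨C, hC, hup⟩ := hK.exists_index_le_mul_pow w
  have hL := F.tendsto_log_index
  have hM : (0 : ℝ) < (m : ℝ) ^ w.length := by
    have : (0 : ℝ) < m := by exact_mod_cast (by omega : 0 < m)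
    positivity
  have hconst : Filter.Tendsto (fun i => (Real.log (F.seq i).index * ((m : ℝ) ^ w.length)⁻¹) /
      Real.log (F.seq i).index) Filter.atTop (𝓝 ((m : ℝ) ^ w.length)⁻¹) := by
    refine tendsto_const_nhds.congr' ?_
    filter_upwards [hL.eventually_gt_atTop 0] with i hi
    field_simp
  refine tendsto_div_of_sandwich (e := fun _ => Real.log C * ((m : ℝ) ^ w.length)⁻¹)
    (fun i => Real.log_natCast_nonneg _) hconst (hL.const_div_atTop _) ?_ ?_
  · refine Filter.Eventually.of_forall fun i => ?_
    have h1 : ((F.seq i).index : ℝ) ≤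
        C * ((F.seq i).relIndex (rist G.topologicalClosure w) : ℝ) ^ m ^ w.length := by
      exact_mod_cast hup F i
    have hpos : (0 : ℝ) < (F.seq i).index := by
      exact_mod_cast Nat.pos_of_ne_zero (F.index_ne_zero i)
    have hrpos : ((F.seq i).relIndex (rist G.topologicalClosure w) : ℝ) ≠ 0 := by
      exact_mod_cast Subgroup.relIndex_ne_zero_of_index (F.index_ne_zero i) _
    have h2 := Real.log_le_log hpos h1
    rw [Real.log_mul (by exact_mod_cast hC) (pow_ne_zero _ hrpos), Real.log_pow] at h2
    push_cast at h2
    rw [← sub_nonneg] at h2 ⊢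
    have h3 := mul_nonneg h2 (inv_pos.2 hM).le
    refine h3.trans_eq ?_
    field_simp
    ring
  · filter_upwards [hK.pow_relIndex_rist_le_index hF hw] with i hi
    have h1 : ((F.seq i).relIndex (rist G.topologicalClosure w) : ℝ) ^ m ^ w.length ≤
        (F.seq i).index := by exact_mod_cast hi
    have hrpos : (0 : ℝ) < ((F.seq i).relIndex (rist G.topologicalClosure w) : ℝ) := by
      exact_mod_cast Nat.pos_of_ne_zero
        (Subgroup.relIndex_ne_zero_of_index (F.index_ne_zero i) _)
    have h2 := Real.log_le_log (pow_pos hrpos _) h1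
    rw [Real.log_pow] at h2
    push_cast at h2
    rw [← div_eq_mul_inv, le_div_iff₀ hM, mul_comm]
    exact h2

/-- If `L` has finite index in `G`, then its copy at `w` has boundedly small index in the rigid
stabilizer of `w`, modulo each term of a filtration. -/
theorem exists_relIndex_rist_le (hK : IsNormalBranch G K) {L : Subgroup (TreeAut m)} (hLK : L ≤ K)
    (hL : L.relIndex G ≠ 0) (w : Vertex m) :
    ∃ C : ℕ, C ≠ 0 ∧ ∀ (F : FiltrationSeries G.topologicalClosure) (i : ℕ),
      (F.seq i).relIndex (rist G.topologicalClosure w) ≤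
        C * (F.seq i).relIndex (placed G.topologicalClosure L w) := by
  -- Sections of the rigid stabilizer lie in the closure of G, so finiteness of the index of
  -- closures is transported along the injective `place w`.
  have hC : (placed G.topologicalClosure L.topologicalClosure w).relIndex
      (rist G.topologicalClosure w) ≠ 0 := by
    have h1 : (L.topologicalClosure.map (place w)).relIndex
        (G.topologicalClosure.map (place w)) ≠ 0 := by
      rw [Subgroup.relIndex_map_map_of_injective _ _ (place_injective w)]
      exact Subgroup.relIndex_topologicalClosure_ne_zero hL
    have h2 : (rist G.topologicalClosure w).map G.topologicalClosure.subtype ≤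
        G.topologicalClosure.map (place w) := by
      rintro _ ⟨g, hg, rfl⟩
      exact ⟨sec g.1 w, sec_mem_topologicalClosure hK.sec_mem g.2 w,
        (SupportedAt.eq_place (g := g.1) hg).symm⟩
    rw [placed, Subgroup.subgroupOf, Subgroup.relIndex_comap]
    exact fun h => h1 (Subgroup.relIndex_eq_zero_of_le_right h2 h)
  refine ⟨_, hC, fun F i => ?_⟩
  have hFi := F.index_ne_zero i
  refine (Subgroup.relIndex_le_mul_inf hFi hC).trans (Nat.mul_le_mul_left _ ?_)
  rw [← Subgroup.relIndex_sup_right (placed G.topologicalClosure L w) (F.seq i)]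
  refine Subgroup.relIndex_le_relIndex_of_le hFi (inf_le_left.trans ?_)
  rintro d ⟨l, hl, hld⟩
  -- The copy of L is dense in the copy of its closure, and Γ_i is open, so both have the same image
  -- modulo Γ_i.
  have hd : d ∈ closure (placed G.topologicalClosure L w : Set G.topologicalClosure) := by
    rw [closure_subtype, show (d : TreeAut m) = place w l from hld.symm]
    refine map_mem_closure (continuous_place w) hl fun l' hl' => ?_
    exact ⟨⟨place w l', G.le_topologicalClosure (hK.le (hK.place_mem w l' (hLK hl')))⟩,
      ⟨l', hl', rfl⟩, rfl⟩
  obtain ⟨p, hp1, hp2⟩ := _root_.mem_closure_iff.1 hd {x | x⁻¹ * d ∈ F.seq i}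
    ((F.isOpen i).preimage (continuous_inv.mul continuous_const))
    (by simp [one_mem])
  have h3 := Subgroup.mul_mem_sup hp2 (show p⁻¹ * d ∈ F.seq i from hp1)
  rwa [mul_inv_cancel_left] at h3

/-- The copies of the commutator subgroup of `K` have asymptotically the full size. -/
def IsFull (G K : Subgroup (TreeAut m)) (F : FiltrationSeries G.topologicalClosure) : Prop :=
  ∀ w : Vertex m, 1 ≤ w.length →
    Filter.Tendsto (fun i => Real.log ((F.seq i).relIndex (placed G.topologicalClosure ⁅K, K⁆ w)) /
      Real.log (F.seq i).index) Filter.atTop (𝓝 ((m : ℝ) ^ w.length)⁻¹)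

theorem commutator_le_self (K : Subgroup (TreeAut m)) : ⁅K, K⁆ ≤ K :=
  Subgroup.commutator_le.2 fun _ hx _ hy =>
    mul_mem (mul_mem (mul_mem hx hy) (inv_mem hx)) (inv_mem hy)

theorem log_placed_le (L : Subgroup (TreeAut m)) (F : FiltrationSeries G.topologicalClosure)
    (w : Vertex m) (i : ℕ) :
    Real.log ((F.seq i).relIndex (placed G.topologicalClosure L w)) ≤
      Real.log ((F.seq i).relIndex (rist G.topologicalClosure w)) := by
  refine Real.log_le_log ?_ ?_
  · exact_mod_cast Nat.pos_of_ne_zero (Subgroup.relIndex_ne_zero_of_index (F.index_ne_zero i) _)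
  · exact_mod_cast Subgroup.relIndex_le_relIndex_of_le (F.index_ne_zero i) (placed_le_rist _ _ _)

theorem isFull_of_relIndex_ne_zero (hm : 2 ≤ m) (hK : IsNormalBranch G K)
    (h : (⁅K, K⁆ : Subgroup (TreeAut m)).relIndex G ≠ 0) {F : FiltrationSeries G.topologicalClosure}
    (hF : IsDirect F) : IsFull G K F := by
  intro w hw
  have : Infinite G.topologicalClosure := hK.transitive_closure.infinite hm
  obtain ⟨C, hC, hup⟩ := hK.exists_relIndex_rist_le (commutator_le_self K) h w
  refine tendsto_div_of_sandwich (e := fun _ => Real.log C)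
    (fun i => Real.log_natCast_nonneg _) (hK.tendsto_log_relIndex_rist hm hF hw)
    (F.tendsto_log_index.const_div_atTop _) (Filter.Eventually.of_forall fun i => ?_)
    (Filter.Eventually.of_forall fun i => log_placed_le _ F w i)
  have hpos : ∀ H, (0 : ℝ) < (F.seq i).relIndex H := fun H => by
    exact_mod_cast Nat.pos_of_ne_zero (Subgroup.relIndex_ne_zero_of_index (F.index_ne_zero i) H)
  have h1 : ((F.seq i).relIndex (rist G.topologicalClosure w) : ℝ) ≤
      C * (F.seq i).relIndex (placed G.topologicalClosure ⁅K, K⁆ w) := by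
    exact_mod_cast hup F i
  have h2 := Real.log_le_log (hpos _) h1
  rw [Real.log_mul (by exact_mod_cast hC) (hpos _).ne'] at h2
  linarith

/-! #### The filtration by level stabilizers -/

theorem relIndex_placed (hK : IsNormalBranch G K) {L : Subgroup (TreeAut m)} (hLK : L ≤ K)
    (w : Vertex m) (n : ℕ) :
    ((levelStabFiltration G.topologicalClosure).seq n).relIndex (placed G.topologicalClosure L w) =
      (levelStab m n).relIndex (L.map (place w)) := by
  have h : L.map (place w) ≤ G.topologicalClosure := by
    rintro _ ⟨l, hl, rfl⟩
    exact G.le_topologicalClosure (hK.le (hK.place_mem w l (hLK hl)))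
  exact Subgroup.relIndex_subgroupOf h

/-- The rigid stabilizer contains a copy of K, and G, in which K has finite index, induces at least
m ^ n permutations of level n by transitivity. -/
theorem pow_le_mul_relIndex_rist (hm : 2 ≤ m) (hK : IsNormalBranch G K) (w : Vertex m) (n : ℕ) :
    m ^ n ≤ K.relIndex G * ((levelStabFiltration G.topologicalClosure).seq (w.length + n)).relIndex
      (rist G.topologicalClosure w) := by
  have hn := index_levelStab_ne_zero (m := m) n
  refine (pow_le_relIndex_levelStab (by omega) hK.transitive n).trans
    ((Subgroup.relIndex_le_mul_inf hn hK.relIndex_ne_zero).trans (Nat.mul_le_mul_left _ ?_))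
  refine (Subgroup.relIndex_le_relIndex_of_le hn inf_le_left).trans ?_
  have h1 : (levelStab m n).relIndex K = (levelStab m (w.length + n)).relIndex (K.map (place w)) := by
    rw [← Subgroup.relIndex_comap]
    congr 1
    ext g
    exact place_mem_levelStab.symm
  rw [h1, ← hK.relIndex_placed le_rfl]
  exact Subgroup.relIndex_le_relIndex_of_le (FiltrationSeries.index_ne_zero _ _)
    (placed_le_rist _ _ _)

/-- Each of the m ^ k rigid stabilizers of level k contributes at least (n - k) log m up to a
constant, and k is arbitrary, so log |Γ : Γ_n| is superlinear in n. -/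
theorem tendsto_div_log_index (hm : 2 ≤ m) (hK : IsNormalBranch G K) :
    Filter.Tendsto (fun n : ℕ => (n : ℝ) /
      Real.log ((levelStabFiltration G.topologicalClosure).seq n).index) Filter.atTop (𝓝 0) := by
  set F := levelStabFiltration G.topologicalClosure
  have hm1 : (1 : ℝ) < m := by exact_mod_cast (by omega : 1 < m)
  have hlog : 0 < Real.log m := Real.log_pos hm1
  have hq : (0 : ℝ) < K.relIndex G := by exact_mod_cast Nat.pos_of_ne_zero hK.relIndex_ne_zero
  have key : ∀ k : ℕ, 1 ≤ k → ∀ᶠ n : ℕ in Filter.atTop,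
      (m : ℝ) ^ k * (n * (Real.log m / 2)) ≤ Real.log (F.seq n).index := by
    intro k hk
    let w : Vertex m := List.replicate k ⟨0, by omega⟩
    have hw : w.length = k := List.length_replicate
    -- For large n half of n log m absorbs the loss k log m + log |G : K|.
    have hbig : ∀ᶠ n : ℕ in Filter.atTop,
        k * Real.log m + Real.log (K.relIndex G) ≤ n * (Real.log m / 2) :=
      (tendsto_natCast_atTop_atTop.atTop_mul_const (by positivity)).eventually_ge_atTop _
    filter_upwards [hK.pow_relIndex_rist_le_index (isDirect_levelStabFiltration _) (w := w)
      (by omega), hbig, Filter.eventually_ge_atTop k] with n h1 h2 h3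
    obtain ⟨j, rfl⟩ := Nat.exists_eq_add_of_le h3
    have h4 := hK.pow_le_mul_relIndex_rist hm w j
    rw [hw] at h1 h4
    have hrpos : (0 : ℝ) < ((F.seq (k + j)).relIndex (rist G.topologicalClosure w) : ℝ) := by
      exact_mod_cast Nat.pos_of_ne_zero
        (Subgroup.relIndex_ne_zero_of_index (F.index_ne_zero _) _)
    have h5 : (m : ℝ) ^ j ≤ K.relIndex G *
        ((F.seq (k + j)).relIndex (rist G.topologicalClosure w) : ℝ) := by exact_mod_cast h4
    have h6 : ((F.seq (k + j)).relIndex (rist G.topologicalClosure w) : ℝ) ^ m ^ k ≤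
        (F.seq (k + j)).index := by exact_mod_cast h1
    have h7 := Real.log_le_log (by positivity) h5
    have h8 := Real.log_le_log (by positivity) h6
    rw [Real.log_pow, Real.log_mul hq.ne' hrpos.ne'] at h7
    rw [Real.log_pow] at h8
    push_cast at h2 h8 ⊢
    refine le_trans (mul_le_mul_of_nonneg_left ?_ (by positivity)) h8
    linarith
  rw [tendsto_order]
  refine ⟨fun a ha => Filter.Eventually.of_forall fun n => ha.trans_le ?_, fun a ha => ?_⟩
  · exact div_nonneg (Nat.cast_nonneg n) (Real.log_natCast_nonneg _)
  · obtain ⟨k, hk⟩ := ((tendsto_pow_atTop_atTop_of_one_lt hm1).eventually_gt_atTop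
      (2 / (a * Real.log m))).and (Filter.eventually_ge_atTop 1) |>.exists
    filter_upwards [key k hk.2, Filter.eventually_gt_atTop 0] with n h1 h2
    have hn : (0 : ℝ) < n := by exact_mod_cast h2
    have hp : (0 : ℝ) < (m : ℝ) ^ k * (n * (Real.log m / 2)) := by positivity
    rw [div_lt_iff₀ (hp.trans_le h1)]
    refine lt_of_lt_of_le ?_ (mul_le_mul_of_nonneg_left h1 ha.le)
    have h3 := hk.1
    rw [div_lt_iff₀ (by positivity)] at h3
    nlinarith

/-- The image of K in the finite group of permutations of level n has exponent dividing (m!) ^ n, so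
its abelianization is small. -/
theorem relIndex_placed_le_commutator (hK : IsNormalBranch G K) [Group.FG K] (w : Vertex m) (n : ℕ) :
    ((levelStabFiltration G.topologicalClosure).seq n).relIndex (placed G.topologicalClosure K w) ≤
      ((levelStabFiltration G.topologicalClosure).seq n).relIndex
        (placed G.topologicalClosure ⁅K, K⁆ w) * (m.factorial ^ n) ^ Group.rank K := by
  rw [hK.relIndex_placed le_rfl, hK.relIndex_placed (commutator_le_self K)]
  let f : K →* TreeAut m := (place w).comp K.subtype
  have h1 := Subgroup.index_le_relIndex_commutator_mul ((levelStab m n).comap f)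
    (e := m.factorial ^ n) (by positivity) (fun k => by
      rw [Subgroup.mem_comap, map_pow]
      exact pow_factorial_pow_mem_levelStab _ n)
  rw [← Subgroup.relIndex_top_right, Subgroup.relIndex_comap, Subgroup.relIndex_comap,
    ← Subgroup.map_map, ← Subgroup.map_map, commutator_def, Subgroup.map_commutator,
    ← MonoidHom.range_eq_map, Subgroup.range_subtype] at h1
  exact h1

/-- The logarithmic loss is a constant plus n · rank K · log m!, negligible by
`tendsto_div_log_index`. -/
theorem isFull_levelStabFiltration (hm : 2 ≤ m) (hK : IsNormalBranch G K) [Group.FG K] :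
    IsFull G K (levelStabFiltration G.topologicalClosure) := by
  intro w hw
  set F := levelStabFiltration G.topologicalClosure
  have : Infinite G.topologicalClosure := hK.transitive_closure.infinite hm
  obtain ⟨C, hC, hup⟩ := hK.exists_relIndex_rist_le le_rfl hK.relIndex_ne_zero w
  have he : Filter.Tendsto (fun n : ℕ => (Real.log C + n * (Group.rank K * Real.log m.factorial)) /
      Real.log (F.seq n).index) Filter.atTop (𝓝 0) := by
    have h1 := (F.tendsto_log_index.const_div_atTop (Real.log C)).add
      ((hK.tendsto_div_log_index hm).mul_const (Group.rank K * Real.log m.factorial))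
    rw [zero_mul, add_zero] at h1
    refine h1.congr fun n => ?_
    rw [add_div, div_mul_eq_mul_div]
  refine tendsto_div_of_sandwich (fun i => Real.log_natCast_nonneg _)
    (hK.tendsto_log_relIndex_rist hm (isDirect_levelStabFiltration _) hw) he
    (Filter.Eventually.of_forall fun i => ?_)
    (Filter.Eventually.of_forall fun i => log_placed_le _ F w i)
  have hpos : ∀ H, (0 : ℝ) < (F.seq i).relIndex H := fun H => by
    exact_mod_cast Nat.pos_of_ne_zero (Subgroup.relIndex_ne_zero_of_index (F.index_ne_zero i) H)
  have h1 : ((F.seq i).relIndex (rist G.topologicalClosure w) : ℝ) ≤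
      C * ((F.seq i).relIndex (placed G.topologicalClosure ⁅K, K⁆ w) *
        ((m.factorial : ℝ) ^ i) ^ Group.rank K) := by
    exact_mod_cast (hup F i).trans (Nat.mul_le_mul_left C (hK.relIndex_placed_le_commutator w i))
  have hf : (0 : ℝ) < m.factorial := by exact_mod_cast m.factorial_pos
  have h2 := Real.log_le_log (hpos _) h1
  rw [Real.log_mul (by exact_mod_cast hC) (by have := hpos (placed G.topologicalClosure ⁅K, K⁆ w); positivity),
    Real.log_mul (hpos _).ne' (by positivity), Real.log_pow, Real.log_pow] at h2
  linarith

end IsNormalBranch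

end TreeAut

namespace TreeAut

variable {m : ℕ}

/-! ### Words below a real number -/

/-- The word `w` read as a number in base `m`. -/
def wordVal (w : Vertex m) : ℕ := w.foldl (fun n x => n * m + x) 0

theorem wordVal_concat (w : Vertex m) (x : Fin m) : wordVal (w ++ [x]) = wordVal w * m + x := by
  simp [wordVal]

/-- The m-adic interval from `wordVal w` to `wordVal w + 1`, scaled by m ^ (-|w|), contains those of
all extensions of w. -/
theorem wordVal_append (w u : Vertex m) : wordVal w * m ^ u.length ≤ wordVal (w ++ u) ∧
    wordVal (w ++ u) + 1 ≤ (wordVal w + 1) * m ^ u.length := by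
  induction u using List.reverseRecOn with
  | nil => simp
  | append_singleton u x ih =>
    rw [← List.append_assoc, wordVal_concat, List.length_append, List.length_singleton, pow_succ,
      ← mul_assoc, ← mul_assoc]
    have hx := x.2
    constructor
    · exact (Nat.mul_le_mul_right m ih.1).trans (Nat.le_add_right _ _)
    · refine le_trans ?_ (Nat.mul_le_mul_right m ih.2)
      rw [add_mul, one_mul]
      omega

theorem wordVal_lt (w : Vertex m) : wordVal w < m ^ w.length := by
  simpa [wordVal] using (wordVal_append [] w).2

theorem wordVal_inj {u v : Vertex m} (hlen : u.length = v.length) (h : wordVal u = wordVal v) :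
    u = v := by
  induction u using List.reverseRecOn generalizing v with
  | nil => exact (List.length_eq_zero_iff.1 hlen.symm).symm
  | append_singleton u x ih =>
    obtain ⟨v, y, rfl⟩ : ∃ v' y, v = v' ++ [y] := by
      refine ⟨v.dropLast, v.getLast ?_, (List.dropLast_append_getLast _).symm⟩
      rintro rfl
      simp at hlen
    rw [wordVal_concat, wordVal_concat] at h
    have hm : 0 < m := x.pos
    rw [mul_comm, mul_comm (wordVal v)] at h
    have h1 : wordVal u = wordVal v := by
      have := congrArg (· / m) h
      simpa [Nat.mul_add_div hm, Nat.div_eq_of_lt x.2, Nat.div_eq_of_lt y.2] using this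
    rw [h1] at h
    have h2 : x = y := Fin.ext (Nat.add_left_cancel h)
    rw [ih (by simpa using hlen) h1, h2]

/-- The `m`-adic interval of the word `w` lies in `[0, α]`. -/
def Below (α : ℝ) (w : Vertex m) : Prop := (wordVal w + 1 : ℝ) ≤ α * (m : ℝ) ^ w.length

theorem Below.append {α : ℝ} {w : Vertex m} (h : Below α w) (u : Vertex m) :
    Below α (w ++ u) := by
  have h1 : (wordVal (w ++ u) + 1 : ℝ) ≤ (wordVal w + 1) * (m : ℝ) ^ u.length := by
    exact_mod_cast (wordVal_append w u).2
  refine h1.trans ?_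
  rw [List.length_append, pow_add, ← mul_assoc]
  exact mul_le_mul_of_nonneg_right h (by positivity)

theorem not_below_append {α : ℝ} {w : Vertex m} (h : α * (m : ℝ) ^ w.length ≤ wordVal w)
    (u : Vertex m) : ¬ Below α (w ++ u) := by
  intro hb
  have h1 : (wordVal w : ℝ) * (m : ℝ) ^ u.length ≤ wordVal (w ++ u) := by
    exact_mod_cast (wordVal_append w u).1
  have h2 : α * (m : ℝ) ^ w.length * (m : ℝ) ^ u.length ≤ wordVal w * (m : ℝ) ^ u.length :=
    mul_le_mul_of_nonneg_right h (by positivity)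
  rw [Below, List.length_append, pow_add, ← mul_assoc] at hb
  linarith

/-- The shortest words whose `m`-adic intervals lie in `[0, α]`. -/
def minimalBelow (m : ℕ) (α : ℝ) : Set (Vertex m) :=
  {v | Below α v ∧ ∀ p, p <+: v → Below α p → p = v}

theorem prefixFree_minimalBelow (α : ℝ) : PrefixFree (minimalBelow m α) :=
  fun _ hv _ hw h => hw.2 _ h hv.1

theorem Below.exists_prefix {α : ℝ} {w : Vertex m} (h : Below α w) :
    ∃ v ∈ minimalBelow m α, v <+: w := by
  induction hn : w.length using Nat.strong_induction_on generalizing w with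
  | _ n ih =>
    by_cases hw : ∀ p, p <+: w → Below α p → p = w
    · exact ⟨w, ⟨h, hw⟩, List.prefix_rfl⟩
    · push Not at hw
      obtain ⟨p, hp, hpb, hpw⟩ := hw
      have hlt : p.length < n := by
        rw [← hn]
        exact lt_of_le_of_ne hp.length_le fun h => hpw (hp.eq_of_length h)
      obtain ⟨v, hv, hvp⟩ := ih p.length hlt hpb rfl
      exact ⟨v, hv, hvp.trans hp⟩

/-- The words of length `k`. -/
def levelFinset (m k : ℕ) : Finset (Vertex m) :=
  Finset.univ.map (Function.Embedding.subtype fun v : Vertex m => v.length = k)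

theorem mem_levelFinset {k : ℕ} {v : Vertex m} : v ∈ levelFinset m k ↔ v.length = k := by
  simp [levelFinset]

theorem card_levelFinset (m k : ℕ) : (levelFinset m k).card = m ^ k := by
  rw [levelFinset, Finset.card_map, Finset.card_univ, card_level]

theorem wordVal_injOn (m k : ℕ) : Set.InjOn wordVal (levelFinset m k : Set (Vertex m)) :=
  fun _ hu _ hv h => wordVal_inj ((mem_levelFinset.1 hu).trans (mem_levelFinset.1 hv).symm) h

theorem exists_finset_upper {α : ℝ} (hα : 0 ≤ α) (k : ℕ) :
    ∃ A : Finset (Vertex m), (∀ w ∈ A, w.length = k) ∧ (A.card : ℝ) ≤ α * (m : ℝ) ^ k + 1 ∧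
      ∀ w : Vertex m, w.length = k → w ∉ A → α * (m : ℝ) ^ k ≤ wordVal w := by
  classical
  -- These are the intervals that start before α; the extra 1 in the bound allows for one that
  -- straddles α.
  refine ⟨(levelFinset m k).filter fun w => (wordVal w : ℝ) < α * (m : ℝ) ^ k,
    fun w hw => mem_levelFinset.1 (Finset.mem_filter.1 hw).1, ?_, fun w hw hwA => ?_⟩
  · have h1 : ((levelFinset m k).filter fun w => (wordVal w : ℝ) < α * (m : ℝ) ^ k).card ≤
        (Finset.range ⌈α * (m : ℝ) ^ k⌉₊).card := by
      refine Finset.card_le_card_of_injOn wordVal (fun w hw => ?_)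
        ((wordVal_injOn m k).mono fun w hw => (Finset.mem_filter.1 hw).1)
      exact Finset.mem_coe.2 (Finset.mem_range.2 (Nat.lt_ceil.2 (Finset.mem_filter.1 hw).2))
    rw [Finset.card_range] at h1
    exact (Nat.cast_le.2 h1).trans (Nat.ceil_lt_add_one (by positivity)).le
  · by_contra hlt
    exact hwA (Finset.mem_filter.2 ⟨mem_levelFinset.2 hw, not_le.1 hlt⟩)

theorem exists_finset_below {α : ℝ} (hα : 0 ≤ α) (hα1 : α ≤ 1) (j : ℕ) :
    ∃ A : Finset (Vertex m), (∀ w ∈ A, w.length = j ∧ Below α w) ∧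
      α * (m : ℝ) ^ j - 1 ≤ A.card := by
  classical
  refine ⟨(levelFinset m j).filter fun w => Below α w, fun w hw =>
    ⟨mem_levelFinset.1 (Finset.mem_filter.1 hw).1, (Finset.mem_filter.1 hw).2⟩, ?_⟩
  have h1 := Finset.card_filter_add_card_filter_not (s := levelFinset m j) fun w => Below α w
  -- An interval not inside [0, α] ends beyond α, so its value is at least the floor of α m ^ j.
  have h2 : ((levelFinset m j).filter fun w => ¬ Below α w).card ≤
      (Finset.Ico ⌊α * (m : ℝ) ^ j⌋₊ (m ^ j)).card := by
    refine Finset.card_le_card_of_injOn wordVal (fun w hw => ?_)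
      ((wordVal_injOn m j).mono fun w hw => (Finset.mem_filter.1 hw).1)
    obtain ⟨hw1, hw2⟩ := Finset.mem_filter.1 hw
    rw [mem_levelFinset] at hw1
    rw [Below, hw1, not_le] at hw2
    refine Finset.mem_coe.2 (Finset.mem_Ico.2 ⟨Nat.lt_succ_iff.1 ?_, hw1 ▸ wordVal_lt w⟩)
    rw [Nat.floor_lt (by positivity)]
    exact_mod_cast hw2
  rw [card_levelFinset] at h1
  rw [Nat.card_Ico] at h2
  have h3 : ⌊α * (m : ℝ) ^ j⌋₊ ≤ m ^ j := by
    have : α * (m : ℝ) ^ j ≤ ((m ^ j : ℕ) : ℝ) := by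
      push_cast
      exact mul_le_of_le_one_left (by positivity) hα1
    exact (Nat.floor_le_floor this).trans (Nat.floor_natCast _).le
  have h4 : ⌊α * (m : ℝ) ^ j⌋₊ ≤ ((levelFinset m j).filter fun w => Below α w).card := by omega
  have h5 := Nat.lt_floor_add_one (α * (m : ℝ) ^ j)
  have h6 : (⌊α * (m : ℝ) ^ j⌋₊ : ℝ) ≤ ((levelFinset m j).filter fun w => Below α w).card := by
    exact_mod_cast h4
  linarith

/-- Words of length j below α have a minimal prefix of length at most j. Appending j arbitrary
letters makes them at least twice as long as that prefix, as `place_commutator_mem` requires. -/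
theorem exists_finset_lower {α : ℝ} (hα : 0 ≤ α) (hα1 : α ≤ 1) (j : ℕ) :
    ∃ B : Finset (Vertex m), (∀ w ∈ B, w.length = j + j ∧
        ∃ v ∈ minimalBelow m α, v <+: w ∧ v.length ≤ j) ∧
      (α * (m : ℝ) ^ j - 1) * (m : ℝ) ^ j ≤ B.card := by
  classical
  obtain ⟨A, hA, hcard⟩ := exists_finset_below (m := m) hα hα1 j
  refine ⟨(A ×ˢ levelFinset m j).image fun p => p.1 ++ p.2, fun w hw => ?_, ?_⟩
  · obtain ⟨⟨a, c⟩, hac, rfl⟩ := Finset.mem_image.1 hw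
    obtain ⟨ha, hc⟩ := Finset.mem_product.1 hac
    have hlen := (hA a ha).1
    obtain ⟨v, hv, hva⟩ := (hA a ha).2.exists_prefix
    refine ⟨?_, v, hv, hva.trans (List.prefix_append _ _), hlen ▸ hva.length_le⟩
    rw [List.length_append, hlen, mem_levelFinset.1 hc]
  · rw [Finset.card_image_of_injOn, Finset.card_product, card_levelFinset]
    · push_cast
      exact mul_le_mul_of_nonneg_right hcard (by positivity)
    · rintro ⟨a, c⟩ h ⟨a', c'⟩ h' heq
      have ha := (hA a (Finset.mem_product.1 h).1).1
      have ha' := (hA a' (Finset.mem_product.1 h').1).1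
      obtain ⟨h1, h2⟩ := List.append_inj heq (ha.trans ha'.symm)
      exact Prod.ext h1 h2

/-! ### Subgroups generated by grafted elements -/

theorem graft_mulSingle [DecidableEq (Vertex m)] {V : Set (Vertex m)} (hV : PrefixFree V)
    {v : Vertex m} (hv : v ∈ V) (g : TreeAut m) : graft hV (Pi.mulSingle v g) = place v g := by
  refine ext_apply fun u => ?_
  by_cases h : ∃ w ∈ V, w <+: u
  · obtain ⟨w, hw, z, rfl⟩ := h
    rw [graft_apply_append hV _ hw]
    by_cases hwv : w = v
    · subst hwv
      rw [place_apply_append, Pi.mulSingle_eq_same]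
    · rw [Pi.mulSingle_eq_of_ne hwv, one_apply, place_apply_of_not]
      exact fun h => hwv (hV.eq_of_prefix hw hv (List.prefix_append _ _) h)
  · rw [graft_apply_of_not hV _ h, place_apply_of_not]
    exact fun h' => h ⟨v, hv, h'⟩

theorem conj_graft_place {V : Set (Vertex m)} (hV : PrefixFree V) {v : Vertex m} (hv : v ∈ V)
    (s : Vertex m → TreeAut m) (g : TreeAut m) :
    graft hV s * place v g * (graft hV s)⁻¹ = place v (s v * g * (s v)⁻¹) := by
  have h1 : (graft hV s).1 v = v := by
    have := graft_apply_append hV s hv []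
    rwa [(s v).2.1, List.append_nil] at this
  have h2 : s v = sec (graft hV s) v :=
    IsSection.eq_sec fun u => by rw [h1, graft_apply_append hV s hv]
  rw [conj_place, h1, ← h2]

theorem isClosed_coneFixer (Γ : Subgroup (TreeAut m)) (w : Vertex m) :
    IsClosed (coneFixer Γ w : Set Γ) := by
  have : (coneFixer Γ w : Set Γ) = ⋂ u, Subtype.val ⁻¹' {g : TreeAut m | g.1 (w ++ u) = w ++ u} := by
    ext g
    rw [Set.mem_iInter]
    exact Iff.rfl
  rw [this]
  exact isClosed_iInter fun u => (isClosed_fixing _).preimage continuous_subtype_val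

open scoped commutatorElement

namespace IsNormalBranch

variable {G K : Subgroup (TreeAut m)}

theorem conj_mem_commutator (hK : IsNormalBranch G K) {g c : TreeAut m} (hg : g ∈ G)
    (hc : c ∈ (⁅K, K⁆ : Subgroup (TreeAut m))) : g * c * g⁻¹ ∈ (⁅K, K⁆ : Subgroup (TreeAut m)) := by
  have h : (⁅K, K⁆ : Subgroup (TreeAut m)) ≤
      (⁅K, K⁆ : Subgroup (TreeAut m)).comap (MulAut.conj g).toMonoidHom := by
    refine Subgroup.commutator_le.2 fun x hx y hy => ?_
    rw [Subgroup.mem_comap, map_commutatorElement]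
    exact Subgroup.commutator_mem_commutator (hK.conj_mem g hg x hx) (hK.conj_mem g hg y hy)
  exact h hc

theorem place_mem_commutator (hK : IsNormalBranch G K) (z : Vertex m) {c : TreeAut m}
    (hc : c ∈ (⁅K, K⁆ : Subgroup (TreeAut m))) : place z c ∈ (⁅K, K⁆ : Subgroup (TreeAut m)) := by
  have h : (⁅K, K⁆ : Subgroup (TreeAut m)) ≤
      (⁅K, K⁆ : Subgroup (TreeAut m)).comap (place z) := by
    refine Subgroup.commutator_le.2 fun x hx y hy => ?_
    rw [Subgroup.mem_comap, map_commutatorElement]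
    exact Subgroup.commutator_mem_commutator (hK.place_mem z x hx) (hK.place_mem z y hy)
  exact h hc

/-- The homomorphism that grafts `φ v k` at each vertex `v` of `V`. -/
noncomputable def graftHom (hK : IsNormalBranch G K) {V : Set (Vertex m)} (hV : PrefixFree V)
    (φ : Vertex m → TreeAut m →* TreeAut m) (hφ : ∀ v, ∀ k ∈ K, φ v k ∈ K) :
    K →* G.topologicalClosure where
  toFun k := ⟨graft hV fun v => φ v k, hK.closure_le (hK.graft_mem_closure hV fun v _ => hφ v k k.2)⟩
  map_one' := Subtype.ext
    ((graft_congr hV (t := 1) fun v _ => map_one (φ v)).trans (graft hV).map_one)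
  map_mul' k l := Subtype.ext
    ((graft_congr hV (t := (fun v => φ v k) * fun v => φ v l) fun v _ =>
      map_mul (φ v) k.1 l.1).trans ((graft hV).map_mul _ _))

/-- A subgroup that contains the diagonal copy of `K` in the product over `V`, and for each `t` in a
transversal of `K` in `G` the copy of `K` placed at `t v` in the component `v`, contains the copies
of the commutator subgroup of `K` at all vertices `w` with a prefix in `V` of at most half their
length. -/
theorem place_commutator_mem (hK : IsNormalBranch G K) {V : Set (Vertex m)} (hV : PrefixFree V)
    {T : Finset (TreeAut m)} (hTG : ∀ t ∈ T, t ∈ G) (hT : ∀ g ∈ G, ∃ t ∈ T, t⁻¹ * g ∈ K)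
    {H : Subgroup (TreeAut m)} (hdiag : ∀ k ∈ K, graft hV (fun _ => k) ∈ H)
    (hshift : ∀ t ∈ T, ∀ k ∈ K, graft hV (fun v => place (t.1 v) k) ∈ H)
    {v w : Vertex m} (hv : v ∈ V) (hvw : v <+: w) (hlen : 2 * v.length ≤ w.length)
    {c : TreeAut m} (hc : c ∈ (⁅K, K⁆ : Subgroup (TreeAut m))) : place w c ∈ H := by
  classical
  -- The shifted x sits at t(v') in component v', the diagonal element sits at t(v) in every
  -- component. These vertices are incomparable unless v' = v, so the commutator vanishes off the
  -- component v.
  have isolate : ∀ t ∈ T, ∀ c ∈ (⁅K, K⁆ : Subgroup (TreeAut m)),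
      place v (place (t.1 v) c) ∈ H := by
    intro t ht c hc
    have h : (⁅K, K⁆ : Subgroup (TreeAut m)) ≤ H.comap ((place v).comp (place (t.1 v))) := by
      refine Subgroup.commutator_le.2 fun x hx y hy => ?_
      have h1 : place v (place (t.1 v) ⁅x, y⁆) =
          ⁅graft hV (fun v' => place (t.1 v') x), graft hV (fun _ => place (t.1 v) y)⁆ := by
        rw [← map_commutatorElement, ← graft_mulSingle hV hv]
        refine graft_congr hV fun v' hv' => ?_
        change _ = ⁅place (t.1 v') x, place (t.1 v) y⁆
        by_cases hvv : v' = v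
        · subst hvv
          rw [Pi.mulSingle_eq_same, map_commutatorElement]
        · rw [Pi.mulSingle_eq_of_ne hvv, eq_comm, commutatorElement_eq_one_iff_commute]
          refine (supportedAt_place _ x).commute (supportedAt_place _ y) ?_ ?_ <;>
            rw [apply_prefix_iff]
          · exact fun h => hvv (hV hv' hv h)
          · exact fun h => hvv (hV hv hv' h).symm
      change place v (place (t.1 v) ⁅x, y⁆) ∈ H
      rw [h1]
      have hx' := hshift t ht x hx
      have hy' := hdiag _ (hK.place_mem (t.1 v) y hy)
      exact mul_mem (mul_mem (mul_mem hx' hy') (inv_mem hx')) (inv_mem hy')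
    exact h hc
  have spread : ∀ u : Vertex m, u.length = v.length → ∀ c ∈ (⁅K, K⁆ : Subgroup (TreeAut m)),
      place v (place u c) ∈ H := by
    intro u hu c hc
    obtain ⟨g, hg, rfl⟩ := hK.transitive v u hu.symm
    obtain ⟨t, ht, htg⟩ := hT g hg
    -- g t⁻¹ carries t(v) to g(v) = u and lies in K by normality, so its diagonal copy in H moves
    -- the isolated copy to u.
    have hk : g * t⁻¹ ∈ K := by
      have := hK.conj_mem t (hTG t ht) _ htg
      simpa [mul_assoc] using this
    have h1 : place (g.1 v) c = (g * t⁻¹) * place (t.1 v)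
        (sec (g * t⁻¹)⁻¹ (g.1 v) * c * (sec (g * t⁻¹)⁻¹ (g.1 v))⁻¹) * (g * t⁻¹)⁻¹ := by
      have h2 := conj_place (g * t⁻¹)⁻¹ c (g.1 v)
      have h3 : ((g * t⁻¹)⁻¹).1 (g.1 v) = t.1 v := by
        rw [mul_inv_rev, inv_inv, mul_apply, inv_apply_self]
      rw [h3] at h2
      rw [← h2]
      group
    rw [h1, ← conj_graft_place hV hv fun _ => g * t⁻¹]
    have h4 := hdiag _ hk
    refine mul_mem (mul_mem h4 (isolate t ht _ ?_)) (inv_mem h4)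
    exact hK.conj_mem_commutator (hK.sec_mem _ (hK.le (inv_mem hk)) _) hc
  obtain ⟨u, rfl⟩ := hvw
  rw [List.length_append] at hlen
  -- After v come |v| letters, reached by `spread`; the remaining letters are absorbed because [K,
  -- K] contains its own placed copies.
  rw [← List.take_append_drop v.length u, place_append, place_append]
  refine spread _ ?_ _ (hK.place_mem_commutator _ hc)
  rw [List.length_take]
  omega

/-- The combinatorial data from which the Hausdorff dimension of `H` can be read off: `H` acts
trivially below all but about `α m ^ k` vertices of level `k`, and contains copies of the commutator
subgroup of `K` at about `α m ^ k` vertices of level `k`. -/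
structure HasDensity (G K : Subgroup (TreeAut m)) (H : Subgroup G.topologicalClosure) (α : ℝ) :
    Prop where
  upper : ∀ k : ℕ, ∃ A : Finset (Vertex m), (∀ w ∈ A, w.length = k) ∧
    (A.card : ℝ) ≤ α * (m : ℝ) ^ k + 1 ∧
    ∀ h ∈ H, ∀ w : Vertex m, w.length = k → w ∉ A → ∀ u, h.1.1 (w ++ u) = w ++ u
  lower : ∀ j : ℕ, ∃ B : Finset (Vertex m), (∀ w ∈ B, w.length = j + j) ∧
    (α * (m : ℝ) ^ j - 1) * (m : ℝ) ^ j ≤ B.card ∧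
    ∀ w ∈ B, placed G.topologicalClosure ⁅K, K⁆ w ≤ H

theorem exists_hasDensity (hK : IsNormalBranch G K) [hfg : Group.FG K] :
    ∃ b : ℕ, ∀ α : ℝ, 0 ≤ α → α ≤ 1 → ∃ S : Finset G.topologicalClosure, S.card ≤ b ∧
      HasDensity G K
        (Subgroup.closure (S : Set G.topologicalClosure)).topologicalClosure α := by
  classical
  obtain ⟨S₀, hS₀⟩ := Group.fg_iff.1 hfg
  obtain ⟨hS₀, hS₀fin⟩ := hS₀
  obtain ⟨S₀, rfl⟩ := hS₀fin.exists_finset_coe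
  obtain ⟨T, hTG, hT⟩ := Subgroup.exists_finset_cover_of_relIndex_ne_zero hK.relIndex_ne_zero
  -- One diagonal family and one shifted family for each t; α enters only through V.
  refine ⟨S₀.card + T.card * S₀.card, fun α hα hα1 => ?_⟩
  have hV := prefixFree_minimalBelow (m := m) α
  let Δ : K →* G.topologicalClosure := hK.graftHom hV (fun _ => MonoidHom.id _) fun _ _ hk => hk
  let Z : TreeAut m → K →* G.topologicalClosure := fun t =>
    hK.graftHom hV (fun v => place (t.1 v)) fun v k hk => hK.place_mem _ k hk
  let S : Finset G.topologicalClosure := S₀.image Δ ∪ T.biUnion fun t => S₀.image (Z t)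
  have hrange : ∀ φ : K →* G.topologicalClosure, S₀.image φ ⊆ S → ∀ k,
      φ k ∈ Subgroup.closure (S : Set G.topologicalClosure) := by
    intro φ hφ k
    have h1 : (⊤ : Subgroup K).map φ ≤ Subgroup.closure (S : Set G.topologicalClosure) := by
      rw [← hS₀, MonoidHom.map_closure]
      refine Subgroup.closure_mono ?_
      rw [← Finset.coe_image]
      exact Finset.coe_subset.2 hφ
    exact h1 ⟨k, trivial, rfl⟩
  refine ⟨S, ?_, fun k => ?_, fun j => ?_⟩
  · refine (Finset.card_union_le _ _).trans (add_le_add Finset.card_image_le ?_)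
    exact Finset.card_biUnion_le_card_mul _ _ _ fun t _ => Finset.card_image_le
  · obtain ⟨A, hA, hcard, hAval⟩ := exists_finset_upper (m := m) hα k
    refine ⟨A, hA, hcard, fun h hh w hw hwA => ?_⟩
    have hle : (Subgroup.closure (S : Set G.topologicalClosure)).topologicalClosure ≤
        coneFixer G.topologicalClosure w := by
      refine Subgroup.topologicalClosure_minimal _ ((Subgroup.closure_le _).2 ?_)
        (isClosed_coneFixer _ w)
      -- The interval of w starts at or beyond α, so no extension of w has a prefix in V.
      have hfix : ∀ (s : Vertex m → TreeAut m) (u : Vertex m),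
          (graft hV s).1 (w ++ u) = w ++ u := by
        intro s u
        refine graft_apply_of_not hV s ?_
        rintro ⟨v, hv, z, hz⟩
        have h1 := hv.1.append z
        rw [hz] at h1
        refine not_below_append ?_ u h1
        rw [hw]
        exact hAval w hw hwA
      intro g hg
      rcases Finset.mem_union.1 (Finset.mem_coe.1 hg) with hg | hg
      · obtain ⟨k, -, rfl⟩ := Finset.mem_image.1 hg
        exact hfix _
      · obtain ⟨t, -, hg⟩ := Finset.mem_biUnion.1 hg
        obtain ⟨k, -, rfl⟩ := Finset.mem_image.1 hg
        exact hfix _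
    exact hle hh
  · obtain ⟨B, hB, hcard⟩ := exists_finset_lower (m := m) hα hα1 j
    refine ⟨B, fun w hw => (hB w hw).1, hcard, fun w hw => ?_⟩
    obtain ⟨hlen, v, hv, hvw, hvj⟩ := hB w hw
    rintro g ⟨c, hc, hcg⟩
    have h1 : place w c ∈ (Subgroup.closure (S : Set G.topologicalClosure)).map
        G.topologicalClosure.subtype := by
      refine hK.place_commutator_mem hV hTG hT ?_ ?_ hv hvw (by omega) hc
      · intro k hk
        exact ⟨Δ ⟨k, hk⟩, hrange Δ Finset.subset_union_left _, rfl⟩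
      · intro t ht k hk
        refine ⟨Z t ⟨k, hk⟩, hrange (Z t) ?_ _, rfl⟩
        exact (Finset.subset_biUnion_of_mem (fun t => S₀.image (Z t)) ht).trans
          Finset.subset_union_right
    obtain ⟨g', hg', h2⟩ := h1
    have h3 : g' = g := Subtype.ext (h2.trans hcg)
    rw [← h3]
    exact Subgroup.le_topologicalClosure _ hg'

end IsNormalBranch

end TreeAut

/-! ### Hausdorff dimensions -/

theorem natCast_le_rpow_of_log_le {a b : ℕ} (ha : a ≠ 0) (hb : b ≠ 0) {s : NNReal}
    (h : Real.log a ≤ s * Real.log b) : (a : ℝ≥0∞) ≤ (b : ℝ≥0∞) ^ (s : ℝ) := by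
  have ha' : (0 : ℝ) < a := by exact_mod_cast Nat.pos_of_ne_zero ha
  have hb' : (0 : ℝ) < b := by exact_mod_cast Nat.pos_of_ne_zero hb
  have h1 := ENNReal.ofReal_le_ofReal ((Real.le_rpow_iff_log_le ha' hb').2 h)
  rwa [← ENNReal.ofReal_rpow_of_pos hb', ENNReal.ofReal_natCast, ENNReal.ofReal_natCast] at h1

theorem rpow_le_natCast_of_le_log {a b : ℕ} (ha : a ≠ 0) (hb : b ≠ 0) {s : NNReal}
    (h : s * Real.log b ≤ Real.log a) : (b : ℝ≥0∞) ^ (s : ℝ) ≤ (a : ℝ≥0∞) := by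
  have ha' : (0 : ℝ) < a := by exact_mod_cast Nat.pos_of_ne_zero ha
  have hb' : (0 : ℝ) < b := by exact_mod_cast Nat.pos_of_ne_zero hb
  have h1 := ENNReal.ofReal_le_ofReal ((Real.rpow_le_iff_le_log hb' ha').2 h)
  rwa [← ENNReal.ofReal_rpow_of_pos hb', ENNReal.ofReal_natCast, ENNReal.ofReal_natCast] at h1

theorem FiltrationSeries.hdim_le_one {Γ : Type*} [Group Γ] [TopologicalSpace Γ] [Infinite Γ]
    [IsTopologicalGroup Γ] [CompactSpace Γ] (F : FiltrationSeries Γ) (H : Subgroup Γ) :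
    F.hdim (H : Set Γ) ≤ 1 := by
  refine F.hdim_le (s := 1) F.index_ne_zero H (Filter.Eventually.of_forall fun i => ?_)
  rw [NNReal.coe_one, ENNReal.rpow_one]
  exact_mod_cast Subgroup.relIndex_le_index (F.index_ne_zero i) H

namespace TreeAut

variable {m : ℕ}

open scoped commutatorElement

namespace IsNormalBranch

variable {G K : Subgroup (TreeAut m)}

theorem HasDensity.hdim_le (hm : 2 ≤ m) (hK : IsNormalBranch G K)
    {F : FiltrationSeries G.topologicalClosure} (hF : IsDirect F)
    {H : Subgroup G.topologicalClosure} {α : NNReal} (hH : HasDensity G K H α) :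
    F.hdim (H : Set G.topologicalClosure) ≤ α := by
  have : Infinite G.topologicalClosure := hK.transitive_closure.infinite hm
  have hm1 : (1 : ℝ) < m := by exact_mod_cast (by omega : 1 < m)
  refine ENNReal.le_of_forall_pos_le_add fun ε hε _ => ?_
  rw [← ENNReal.coe_add]
  refine F.hdim_le F.index_ne_zero H ?_
  -- With m ^ k > 1/ε the one extra vertex in the bound for |A| costs less than ε.
  obtain ⟨k, hk⟩ := ((tendsto_pow_atTop_atTop_of_one_lt hm1).eventually_gt_atTop
    ((ε : ℝ)⁻¹)).and (Filter.eventually_ge_atTop 1) |>.exists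
  obtain ⟨A, hA, hcard, hfix⟩ := hH.upper k
  obtain ⟨C, hC, hup⟩ := hK.relIndex_le_prod (k := k)
  have hM : (0 : ℝ) < (m : ℝ) ^ k := by positivity
  have hlim : Filter.Tendsto (fun i => (Real.log C + ∑ w : A,
      Real.log ((F.seq i).relIndex (rist G.topologicalClosure w.1))) / Real.log (F.seq i).index)
      Filter.atTop (𝓝 (A.card * ((m : ℝ) ^ k)⁻¹)) := by
    have h1 := (F.tendsto_log_index.const_div_atTop (Real.log C)).add
      (tendsto_finsetSum Finset.univ fun (w : A) _ =>
        hK.tendsto_log_relIndex_rist hm hF (w := w.1) (by rw [hA w.1 w.2]; exact hk.2))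
    have h2 : (0 : ℝ) + ∑ w : A, ((m : ℝ) ^ w.1.length)⁻¹ = A.card * ((m : ℝ) ^ k)⁻¹ := by
      rw [zero_add, Finset.sum_congr rfl fun w _ => by rw [hA w.1 w.2], Finset.sum_const,
        Finset.card_univ, Fintype.card_coe, nsmul_eq_mul]
    rw [h2] at h1
    refine h1.congr fun i => ?_
    rw [add_div, Finset.sum_div]
  have hlt : A.card * ((m : ℝ) ^ k)⁻¹ < ((α + ε : NNReal) : ℝ) := by
    rw [← div_eq_mul_inv, div_lt_iff₀ hM]
    refine hcard.trans_lt ?_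
    have h3 : 1 < (ε : ℝ) * (m : ℝ) ^ k := by
      have hε' : (0 : ℝ) < ε := hε
      have := mul_lt_mul_of_pos_left hk.1 hε'
      rwa [mul_inv_cancel₀ hε'.ne'] at this
    push_cast
    linarith
  filter_upwards [hlim.eventually_lt_const hlt, F.tendsto_log_index.eventually_gt_atTop 0]
    with i hi hL
  have hne : ∀ H, (F.seq i).relIndex H ≠ 0 :=
    Subgroup.relIndex_ne_zero_of_index (F.index_ne_zero i)
  refine natCast_le_rpow_of_log_le (hne H) (F.index_ne_zero i) ?_
  rw [div_lt_iff₀ hL] at hi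
  refine le_trans ?_ hi.le
  have h4 : ((F.seq i).relIndex H : ℝ) ≤
      C * ∏ w : A, ((F.seq i).relIndex (rist G.topologicalClosure w.1) : ℝ) := by
    exact_mod_cast hup F A hA H hfix i
  have h5 := Real.log_le_log (by exact_mod_cast Nat.pos_of_ne_zero (hne H)) h4
  rwa [Real.log_mul (by exact_mod_cast hC)
    (Finset.prod_ne_zero_iff.2 fun w _ => by exact_mod_cast hne _),
    Real.log_prod fun w _ => by exact_mod_cast hne _] at h5

theorem HasDensity.le_hdim (hm : 2 ≤ m) (hK : IsNormalBranch G K)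
    {F : FiltrationSeries G.topologicalClosure} (hF : IsDirect F) (hF' : IsFull G K F)
    {H : Subgroup G.topologicalClosure} (hHc : IsClosed (H : Set G.topologicalClosure))
    {α : NNReal} (hH : HasDensity G K H α) :
    (α : ℝ≥0∞) ≤ F.hdim (H : Set G.topologicalClosure) := by
  have : Infinite G.topologicalClosure := hK.transitive_closure.infinite hm
  have hm1 : (1 : ℝ) < m := by exact_mod_cast (by omega : 1 < m)
  refine ENNReal.le_of_forall_nnreal_lt fun s hs => ?_
  rw [ENNReal.coe_lt_coe] at hs
  rcases eq_or_ne s 0 with rfl | hs0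
  · exact zero_le
  refine F.le_hdim F.index_ne_zero H hHc (pos_iff_ne_zero.2 hs0) ?_
  have hs' : (0 : ℝ) < α - s := sub_pos.2 hs
  -- m ^ j > 1/(α - s) makes (α m ^ j - 1) m ^ j exceed s m ^ (2j).
  obtain ⟨j, hj⟩ := ((tendsto_pow_atTop_atTop_of_one_lt hm1).eventually_gt_atTop
    ((α - s : ℝ)⁻¹)).and (Filter.eventually_ge_atTop 1) |>.exists
  obtain ⟨B, hB, hcard, hBH⟩ := hH.lower j
  have hM : (0 : ℝ) < (m : ℝ) ^ j := by positivity
  have hlim : Filter.Tendsto (fun i => (∑ w : B,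
      Real.log ((F.seq i).relIndex (placed G.topologicalClosure ⁅K, K⁆ w.1))) /
        Real.log (F.seq i).index)
      Filter.atTop (𝓝 (B.card * ((m : ℝ) ^ (j + j))⁻¹)) := by
    have h1 := tendsto_finsetSum Finset.univ fun (w : B) _ =>
        hF' w.1 (by rw [hB w.1 w.2]; omega)
    have h2 : ∑ w : B, ((m : ℝ) ^ w.1.length)⁻¹ = B.card * ((m : ℝ) ^ (j + j))⁻¹ := by
      rw [Finset.sum_congr rfl fun w _ => by rw [hB w.1 w.2], Finset.sum_const,
        Finset.card_univ, Fintype.card_coe, nsmul_eq_mul]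
    rw [h2] at h1
    refine h1.congr fun i => ?_
    rw [Finset.sum_div]
  have hlt : (s : ℝ) < B.card * ((m : ℝ) ^ (j + j))⁻¹ := by
    rw [← div_eq_mul_inv, lt_div_iff₀ (by positivity), pow_add]
    refine lt_of_lt_of_le ?_ hcard
    have h3 : 1 < (α - s : ℝ) * (m : ℝ) ^ j := by
      have := mul_lt_mul_of_pos_left hj.1 hs'
      rwa [mul_inv_cancel₀ hs'.ne'] at this
    rw [← mul_assoc]
    refine mul_lt_mul_of_pos_right ?_ hM
    linarith
  filter_upwards [hlim.eventually_const_lt hlt, F.tendsto_log_index.eventually_gt_atTop 0,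
    hF.relIndex_iSup F.index_ne_zero (by omega : 1 ≤ j + j) B hB
      (P := placed G.topologicalClosure ⁅K, K⁆) (placed_le_rist _ _)] with i hi hL hprod
  have hne : ∀ H, (F.seq i).relIndex H ≠ 0 :=
    Subgroup.relIndex_ne_zero_of_index (F.index_ne_zero i)
  refine rpow_le_natCast_of_le_log (hne H) (F.index_ne_zero i) ?_
  rw [lt_div_iff₀ hL] at hi
  refine hi.le.trans ?_
  have h4 : ∏ w : B, (F.seq i).relIndex (placed G.topologicalClosure ⁅K, K⁆ w.1) ≤
      (F.seq i).relIndex H := by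
    rw [← hprod]
    exact Subgroup.relIndex_le_relIndex_of_le (F.index_ne_zero i)
      (iSup_le fun w => hBH w.1 w.2)
  have h5 : ∏ w : B, ((F.seq i).relIndex (placed G.topologicalClosure ⁅K, K⁆ w.1) : ℝ) ≤
      (F.seq i).relIndex H := by exact_mod_cast h4
  rw [← Real.log_prod fun w _ => by exact_mod_cast hne _]
  refine Real.log_le_log (Finset.prod_pos fun w _ => ?_) h5
  exact_mod_cast Nat.pos_of_ne_zero (hne _)

/-- The subgroups of prescribed density realize every dimension. -/
theorem hspec_eq (hm : 2 ≤ m) (hK : IsNormalBranch G K) {b : ℕ}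
    (hb : ∀ α : ℝ, 0 ≤ α → α ≤ 1 → ∃ S : Finset G.topologicalClosure, S.card ≤ b ∧
      HasDensity G K
        (Subgroup.closure (S : Set G.topologicalClosure)).topologicalClosure α)
    {F : FiltrationSeries G.topologicalClosure} (hF : IsDirect F) (hF' : IsFull G K F) :
    F.hspecBounded b = Set.Icc 0 1 ∧ F.hspecFG = Set.Icc 0 1 ∧ F.hspec = Set.Icc 0 1 := by
  have : Infinite G.topologicalClosure := hK.transitive_closure.infinite hm
  have h1 : F.hspecBounded b ⊆ F.hspecFG := by
    rintro d ⟨H, hH, ⟨S, -, hS⟩, hd⟩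
    exact ⟨H, hH, ⟨S, hS⟩, hd⟩
  have h2 : F.hspecFG ⊆ F.hspec := by
    rintro d ⟨H, hH, -, hd⟩
    exact ⟨H, hH, trivial, hd⟩
  have h3 : F.hspec ⊆ Set.Icc 0 1 := by
    rintro d ⟨H, -, -, rfl⟩
    exact ⟨zero_le, F.hdim_le_one H⟩
  have h4 : Set.Icc 0 1 ⊆ F.hspecBounded b := by
    rintro d ⟨-, hd⟩
    lift d to NNReal using ne_top_of_le_ne_top ENNReal.one_ne_top hd
    obtain ⟨S, hS, hdens⟩ := hb d d.2 (by exact_mod_cast hd)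
    have hcl : IsClosed ((Subgroup.closure (S : Set G.topologicalClosure)).topologicalClosure :
      Set G.topologicalClosure) := Subgroup.isClosed_topologicalClosure _
    exact ⟨_, hcl, ⟨S, hS, rfl⟩,
      le_antisymm (hdens.hdim_le hm hK hF) (hdens.le_hdim hm hK hF hF' hcl)⟩
  exact ⟨(h1.trans (h2.trans h3)).antisymm h4, (h2.trans h3).antisymm (h4.trans h1),
    h3.antisymm (h4.trans (h1.trans h2))⟩

/-! ### The commutator subgroup of K and the just infinite case -/

theorem commutator_ne_bot (hK : IsNormalBranch G K) (hG : Infinite G) :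
    (⁅K, K⁆ : Subgroup (TreeAut m)) ≠ ⊥ := by
  intro hbot
  have hne : K ≠ ⊥ := by
    rintro rfl
    refine hK.relIndex_ne_zero ?_
    rw [Subgroup.relIndex_bot_left]
    exact Nat.card_eq_zero_of_infinite
  obtain ⟨k, hk, hk1⟩ := (Subgroup.ne_bot_iff_exists_ne_one.1 hne).elim
    fun k hk => (⟨k.1, k.2, fun h => hk (Subtype.ext h)⟩ : ∃ k ∈ K, k ≠ 1)
  obtain ⟨u, hu⟩ : ∃ u, k.1 u ≠ u := by
    by_contra! h
    exact hk1 (ext_apply h)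
  -- If K were abelian, k would commute with its own copy at u; but conjugation by k moves that copy
  -- to the disjoint subtree at k(u) ≠ u, so the copy, and k itself, would be trivial.
  have h1 : ⁅k, place u k⁆ = 1 := by
    rw [← Subgroup.mem_bot, ← hbot]
    exact Subgroup.commutator_mem_commutator hk (hK.place_mem u k hk)
  rw [commutatorElement_eq_one_iff_mul_comm, ← mul_inv_eq_iff_eq_mul, conj_place] at h1
  refine hk1 (place_injective u ?_)
  rw [map_one]
  refine ext_apply fun z => ?_
  by_cases hz : u <+: z
  · rw [← h1, place_apply_of_not, one_apply]
    intro hz'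
    exact hu ((prefixFree_of_length (V := {v : Vertex m | v.length = u.length})
      fun _ h => h).eq_of_prefix (length_apply k u) rfl hz' hz)
  · exact place_apply_of_not _ hz

theorem relIndex_commutator_ne_zero (hK : IsNormalBranch G K) (hG : IsJustInfinite G) :
    (⁅K, K⁆ : Subgroup (TreeAut m)).relIndex G ≠ 0 := by
  have hle : (⁅K, K⁆ : Subgroup (TreeAut m)) ≤ G := (commutator_le_self K).trans hK.le
  have hnorm : ((⁅K, K⁆ : Subgroup (TreeAut m)).subgroupOf G).Normal :=
    ⟨fun c hc g => hK.conj_mem_commutator g.2 hc⟩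
  have hne : (⁅K, K⁆ : Subgroup (TreeAut m)).subgroupOf G ≠ ⊥ := by
    intro h
    refine hK.commutator_ne_bot hG.1 (eq_bot_iff.2 fun c hc => ?_)
    have h1 : (⟨c, hle hc⟩ : G) ∈ (⊥ : Subgroup G) := by
      rw [← h]
      exact hc
    exact congrArg Subtype.val (Subgroup.mem_bot.1 h1)
  exact (hG.2 _ hnorm hne).index_ne_zero

theorem fg (hK : IsNormalBranch G K) (hfg : Group.FG G) : Group.FG K := by
  have : (K.subgroupOf G).FiniteIndex := ⟨hK.relIndex_ne_zero⟩
  have h1 : Group.FG (K.subgroupOf G) := inferInstance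
  exact Group.fg_of_surjective (f := (Subgroup.subgroupOfEquivOfLe hK.le).toMonoidHom)
    (Subgroup.subgroupOfEquivOfLe hK.le).surjective

end IsNormalBranch

end TreeAut

/-! ### Conclusion -/

theorem mainTheorem1 (m : ℕ) (hm : 2 ≤ m) (G : Subgroup (TreeAut m)) (hfg : Group.FG G)
    (hG : TreeAut.IsRegularBranch G) :
    ∃ b : ℕ, 2 ≤ b ∧
      ((TreeAut.levelStabFiltration G.topologicalClosure).hspecBounded b = Set.Icc 0 1 ∧
        (TreeAut.levelStabFiltration G.topologicalClosure).hspecFG = Set.Icc 0 1 ∧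
        (TreeAut.levelStabFiltration G.topologicalClosure).hspec = Set.Icc 0 1) ∧
      (IsJustInfinite G → ∀ N : FiltrationSeries G.topologicalClosure,
        TreeAut.IsNice G.topologicalClosure N →
          N.hspecBounded b = Set.Icc 0 1 ∧ N.hspecFG = Set.Icc 0 1 ∧
            N.hspec = Set.Icc 0 1) := by
  obtain ⟨K, hK⟩ := hG.exists_isNormalBranch
  have : Group.FG K := hK.fg hfg
  obtain ⟨b, hb⟩ := hK.exists_hasDensity
  have hb' : ∀ α : ℝ, 0 ≤ α → α ≤ 1 → ∃ S : Finset G.topologicalClosure, S.card ≤ b + 2 ∧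
      TreeAut.IsNormalBranch.HasDensity G K
        (Subgroup.closure (S : Set G.topologicalClosure)).topologicalClosure α :=
    fun α h0 h1 => (hb α h0 h1).imp fun S hS => ⟨hS.1.trans (Nat.le_add_right b 2), hS.2⟩
  -- Adding 2 only secures the requirement b ≥ 2; a larger bound on the number of generators is
  -- harmless.
  refine ⟨b + 2, Nat.le_add_left 2 b, ?_, fun hji N hN => ?_⟩
  · exact hK.hspec_eq hm hb' (TreeAut.isDirect_levelStabFiltration _)
      (hK.isFull_levelStabFiltration hm)
  · have hdir := hN.isDirect N.index_ne_zero
    exact hK.hspec_eq hm hb' hdir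
      (hK.isFull_of_relIndex_ne_zero hm (hK.relIndex_commutator_ne_zero hji) hdir)
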